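/- **Setting.** Consider a finite set of nodes $A_1,\dots,A_m$; for each ordered pair $(i,j)$ let $\gamma_{ij}$ be an arc from $A_i$ to $A_j$ with speed $v_{ij}(\rho)$, flux $F_{ij}(\rho)=\rho\,v_{ij}(\rho)$, length $L_{ij}$ and maximal density $\bar\rho_{ij}$. The arc is *viable* if $v_{ij}(0)>0$. There are $n$ groups of drivers; group $k$ travels from $A_{d(k)}$ to $A_{a(k)}$ and has departure cost $\varphi_k$ and arrival cost $\psi_k$. Let $\mathcal V_k$ be the set of chains $\Gamma_p$ of at least one viable arc, without closed loops, from $A_{d(k)}$ to $A_{a(k)}$; assume $\mathcal V_k\neq\emptyset$ for every $k$. Below $(k,p)$ ranges over pairs with $\Gamma_p\in\mathcal V_k$. (A1) For every viable arc, $L_{ij}>0$, $\bar\rho_{ij}>0$, and on $[0,\bar\rho_{ij}]$ the speed $v_{ij}$ is continuous and nonincreasing, and $F_{ij}$ is continuous, concave and nonnegative with $F_{ij}(0)=F_{ij}(\bar\rho_{ij})=0$. (A2) For every $k$, $\varphi_k,\psi_k:\mathbb R\to\mathbb R$ are $C^1$ with $\varphi_k'<0$, $\psi_k'>0$ and $\varphi_k(t)+\psi_k(t)\to+\infty$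 as $|t|\to\infty$. *Departures.* Given $G_1,\dots,G_n\ge 0$, a family $U_{k,p}:\mathbb R\to\mathbb R$ is *admissible* if each $U_{k,p}$ is bounded, nondecreasing, left-continuous, with $U_{k,p}(-\infty)=0$, and $\sum_p U_{k,p}(+\infty)=G_k$ for every $k$. Put $G_{k,p}=U_{k,p}(+\infty)$. Let $S_{ij}$ be the set of $(k,p)$ with $d(k)=i$ and $\gamma_{ij}\in\Gamma_p$, and put $U^{dep}_{ij}=\sum_{(k,p)\in S_{ij}}U_{k,p}$, $G_{ij}=\sum_{(k,p)\in S_{ij}}G_{k,p}$. *Prioritizing functions* are nondecreasing maps $B_{k,p}:[0,G_{ij}]\to[0,G_{k,p}]$, for $(k,p)\in S_{ij}$, with $\sum_{(k,p)\in S_{ij}}B_{k,p}(\beta)=\beta$ for all $\beta\in[0,G_{ij}]$ and $B_{k,p}(U^{dep}_{ij}(t))=U_{k,p}(t)$ for a.e. $t$. *Traffic flow.* Let $F^{max}_{ij}=\max_{[0,\bar\rho_{ij}]}F_{ij}$, let $\rho^*_{ij}$ be the smallest maximizer, $g_{ij}:[0,F^{max}_{ij}]\to[0,\rho^*_{ij}]$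 the inverse of $F_{ij}$ on $[0,\rho^*_{ij}]$, and $g^*_{ij}(p)=\max_{u\in[0,F^{max}_{ij}]}(pu-g_{ij}(u))$. A traffic flow for $(U,B)$ is a family of nondecreasing functions $U^+_{kp,ij}$, tending to $0$ at $-\infty$ and identically $0$ if $\gamma_{ij}\notin\Gamma_p$ (the number of $(k,p)$-drivers that have exited from $\gamma_{ij}$ within time $t$), with the following properties. If $\gamma_{ij}\in\Gamma_p$, set $U^-_{kp,ij}=U_{k,p}$ if $\gamma_{ij}$ is the first arc of $\Gamma_p$, and $U^-_{kp,ij}=U^+_{kp,\ell i}$ if $\gamma_{\ell i}$ precedes $\gamma_{ij}$ in $\Gamma_p$; otherwise set $U^-_{kp,ij}=0$. Put $U^\pm_{ij}=\sum_{k,p}U^\pm_{kp,ij}$ and $U^{tr}_{ij}=\sum_{d(k)\ne i}U^-_{kp,ij}$. Then for every viable arc and every $t$, $$U^+_{ij}(t)=\min_\tau\Big\{U^-_{ij}(\tau)+L_{ij}\,g^*_{ij}\Big(\frac{t-\tau}{L_{ij}}\Big)\Big\},$$ and, whenever $U^-_{ij}(\tau-)\le U^+_{ij}(t)\le U^-_{ij}(\tau+)$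 and $\gamma_{ij}\in\Gamma_p$, one has $U^+_{kp,ij}(t)=U^-_{kp,ij}(\tau)$ if $d(k)\neq i$, and $U^+_{kp,ij}(t)=B_{k,p}\big(U^+_{ij}(t)-U^{tr}_{ij}(\tau)\big)$ if $d(k)=i$. *Cost.* Let $U^{arr}_{k,p}=U^+_{kp,i\,a(k)}$, where $\gamma_{i\,a(k)}$ is the last arc of $\Gamma_p$, and put $\tau^d_{k,p}(\beta)=\inf\{t:U_{k,p}(t)\ge\beta\}$, $\tau^a_{k,p}(\beta)=\inf\{t:U^{arr}_{k,p}(t)\ge\beta\}$. The total cost is $$J=\sum_{k,p}\int_0^{G_{k,p}}\Big(\varphi_k(\tau^d_{k,p}(\beta))+\psi_k(\tau^a_{k,p}(\beta))\Big)\,d\beta\in(-\infty,+\infty].$$ **Theorem (existence of a globally optimal solution).** Assume (A1) and (A2). Then for any $G_1,\dots,G_n\ge0$ there exist an admissible family of departure distributions $U_{k,p}$ and prioritizing functions $B_{k,p}$, with a corresponding traffic flow, whose total cost $J$ is finite and is the minimum of $J$ over all admissible families of departure distributions, all prioritizing functions for them, and all corresponding traffic flows. -/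

import Mathlib

open Set Filter Topology MeasureTheory

/-- The data of a traffic problem: a road network with node set `V` and at most one arc from `i` to
`j` for every ordered pair of nodes, together with `n` groups of drivers. -/
structure TrafficModel (V : Type*) (n : ℕ) where
  /-- `speed i j ρ` is the speed of cars on the arc from `i` to `j` at density `ρ`. -/
  speed : V → V → ℝ → ℝ
  /-- The maximal density on each arc. -/
  maxDensity : V → V → ℝ
  /-- The length of each arc. -/
  length : V → V → ℝ
  /-- The departure node of each group. -/
  origin : Fin n → V
  /-- The arrival node of each group. -/
  dest : Fin n → V
  /-- Departure cost of each group, as a function of the departure time. -/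
  departCost : Fin n → ℝ → ℝ
  /-- Arrival cost of each group, as a function of the arrival time. -/
  arriveCost : Fin n → ℝ → ℝ

/-- A departure distribution function: bounded, nondecreasing, left-continuous, with limit `0`
at `-∞`. (Boundedness from below follows from the last condition and monotonicity.) -/
structure IsDepartureDistribution (f : ℝ → ℝ) : Prop where
  bddAbove : BddAbove (range f)
  mono : Monotone f
  left_cont : ∀ t, ContinuousWithinAt f (Iic t) t
  tendsto_atBot : Tendsto f atBot (𝓝 0)

/-- `τ` is an entry time for the level `c`: `f (τ-) ≤ c ≤ f (τ+)`, where `f t` counts the drivers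
that have entered an arc up to time `t`. -/
def IsEntryTime (f : ℝ → ℝ) (c τ : ℝ) : Prop :=
  Function.leftLim f τ ≤ c ∧ c ≤ Function.rightLim f τ

/-- The integral of `f` over `(0, b]`, as an extended real: integral of the positive part minus
integral of the negative part. -/
noncomputable def extIntegral (f : ℝ → ℝ) (b : ℝ) : EReal :=
  ((∫⁻ β in Ioc 0 b, ENNReal.ofReal (f β) : ENNReal) : EReal) -
    ((∫⁻ β in Ioc 0 b, ENNReal.ofReal (-f β) : ENNReal) : EReal)

/-- The time at which the `β`-th driver is counted by the distribution function `f`. -/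
noncomputable def driverTime (f : ℝ → ℝ) (β : ℝ) : ℝ :=
  sInf {t : ℝ | β ≤ f t}

namespace TrafficModel

variable {V : Type*} {n : ℕ} (M : TrafficModel V n)

/-! ### Arcs: flux, inverse flux, Legendre transform -/

/-- An arc is viable if the speed at zero density is positive. -/
def Viable (i j : V) : Prop := 0 < M.speed i j 0

/-- The flux `ρ * v(ρ)`. -/
def flux (i j : V) (ρ : ℝ) : ℝ := ρ * M.speed i j ρ

/-- The maximal flux over densities between zero and the maximal density. -/
noncomputable def maxFlux (i j : V) : ℝ := sSup (M.flux i j '' Icc 0 (M.maxDensity i j))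

/-- The smallest density at which the flux is maximal. -/
noncomputable def critDensity (i j : V) : ℝ :=
  sInf {ρ ∈ Icc 0 (M.maxDensity i j) | M.flux i j ρ = M.maxFlux i j}

/-- The inverse of the flux function, restricted to the increasing branch. -/
noncomputable def invFlux (i j : V) : ℝ → ℝ :=
  Function.invFunOn (M.flux i j) (Icc 0 (M.critDensity i j))

/-- The Legendre transform of the inverse flux. -/
noncomputable def legendre (i j : V) (p : ℝ) : ℝ :=
  sSup ((fun u => p * u - M.invFlux i j u) '' Icc 0 (M.maxFlux i j))

/-- The Lax-Hopf formula at the end of the arc: the number of drivers that have left the arc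
within time `t`, if `f τ` drivers have entered it up to time `τ`. -/
noncomputable def laxHopf (i j : V) (f : ℝ → ℝ) (t : ℝ) : ℝ :=
  ⨅ τ : ℝ, (f τ + M.length i j * M.legendre i j ((t - τ) / M.length i j))

/-! ### Assumptions on the data -/

/-- Assumptions on the viable arcs: positive length; on the interval from zero to the maximal
density the speed is continuous and nonincreasing, and the flux is continuous, concave,
nonnegative, and zero at both ends. -/
structure FluxAssumption : Prop where
  length_pos : ∀ i j, M.Viable i j → 0 < M.length i j
  maxDensity_pos : ∀ i j, M.Viable i j → 0 < M.maxDensity i j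
  speed_cont : ∀ i j, M.Viable i j → ContinuousOn (M.speed i j) (Icc 0 (M.maxDensity i j))
  speed_anti : ∀ i j, M.Viable i j → AntitoneOn (M.speed i j) (Icc 0 (M.maxDensity i j))
  flux_cont : ∀ i j, M.Viable i j → ContinuousOn (M.flux i j) (Icc 0 (M.maxDensity i j))
  flux_concave : ∀ i j, M.Viable i j → ConcaveOn ℝ (Icc 0 (M.maxDensity i j)) (M.flux i j)
  flux_nonneg : ∀ i j, M.Viable i j → ∀ ρ ∈ Icc 0 (M.maxDensity i j), 0 ≤ M.flux i j ρ
  flux_zero : ∀ i j, M.Viable i j → M.flux i j 0 = 0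
  flux_maxDensity : ∀ i j, M.Viable i j → M.flux i j (M.maxDensity i j) = 0

/-- Assumptions on the costs. -/
structure CostAssumption : Prop where
  depart_contDiff : ∀ k, ContDiff ℝ 1 (M.departCost k)
  arrive_contDiff : ∀ k, ContDiff ℝ 1 (M.arriveCost k)
  depart_deriv_neg : ∀ k t, deriv (M.departCost k) t < 0
  arrive_deriv_pos : ∀ k t, 0 < deriv (M.arriveCost k) t
  tendsto_atTop : ∀ k, Tendsto (fun t => M.departCost k t + M.arriveCost k t) atTop atTop
  tendsto_atBot : ∀ k, Tendsto (fun t => M.departCost k t + M.arriveCost k t) atBot atTop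

/-! ### Paths -/

/-- `l` lists the nodes of a nonempty chain of viable arcs from `i` to `j` without closed loop. -/
def IsViablePath (i j : V) (l : List V) : Prop :=
  l.Nodup ∧ l.IsChain M.Viable ∧ 2 ≤ l.length ∧ l.head? = some i ∧ l.getLast? = some j

/-- The viable paths available to group `k`. -/
def Path (k : Fin n) : Type _ := {l : List V // M.IsViablePath (M.origin k) (M.dest k) l}

/-- The subgroups `(k, p)`: the drivers of group `k` that travel along the viable path `p`. -/
def DriverClass : Type _ := Σ k : Fin n, M.Path k

instance [Finite V] (k : Fin n) : Finite (M.Path k) := by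
  classical
  have := Fintype.ofFinite V
  refine Finite.of_injective
    (fun p : M.Path k => (⟨p.1, p.2.1⟩ : {l : List V // l.Nodup})) ?_
  intro p q h
  exact Subtype.ext (congrArg (fun x : {l : List V // l.Nodup} => x.1) h)

noncomputable instance [Finite V] (k : Fin n) : Fintype (M.Path k) := Fintype.ofFinite _

instance [Finite V] : Finite M.DriverClass :=
  inferInstanceAs (Finite (Σ k : Fin n, M.Path k))

noncomputable instance [Finite V] : Fintype M.DriverClass := Fintype.ofFinite _

variable {M}

/-- The path of the subgroup `s` contains the arc from `i` to `j`. -/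
def Uses (s : M.DriverClass) (i j : V) : Prop := [i, j] <:+: s.2.1

/-- The drivers of the subgroup `s` start at `i`, with the arc from `i` to `j` as first leg. -/
def Starts (s : M.DriverClass) (i j : V) : Prop := M.origin s.1 = i ∧ Uses s i j

/-! ### Departures and priorities -/

/-- Total size of a subgroup, the limit at `+∞` of its departure distribution. -/
noncomputable def size (U : M.DriverClass → ℝ → ℝ) (s : M.DriverClass) : ℝ := ⨆ t, U s t

variable [Fintype V]

/-- Admissible families of departure distributions, for the group sizes `G`. -/
def IsAdmissible (G : Fin n → ℝ) (U : M.DriverClass → ℝ → ℝ) : Prop :=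
  (∀ s, IsDepartureDistribution (U s)) ∧ ∀ k, ∑ p : M.Path k, size U ⟨k, p⟩ = G k

open Classical in
/-- Number of drivers that start their journey along the arc from `i` to `j` before time `t`. -/
noncomputable def departCount (U : M.DriverClass → ℝ → ℝ) (i j : V) (t : ℝ) : ℝ :=
  ∑ s with Starts s i j, U s t

open Classical in
/-- Total number of drivers that start their journey along the arc from `i` to `j`. -/
noncomputable def departSize (U : M.DriverClass → ℝ → ℝ) (i j : V) : ℝ :=
  ∑ s with Starts s i j, size U s

open Classical in
/-- `B` consists of prioritizing functions for all arcs; `B s` is a prioritizing function on the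
first arc of the path of `s`, and only its values on `[0, departSize U i j]` are relevant. -/
structure IsPrioritizing (U B : M.DriverClass → ℝ → ℝ) : Prop where
  mono : ∀ s i j, Starts s i j → MonotoneOn (B s) (Icc 0 (departSize U i j))
  mapsTo : ∀ s i j, Starts s i j →
    MapsTo (B s) (Icc 0 (departSize U i j)) (Icc 0 (size U s))
  sum_eq : ∀ i j, ∀ β ∈ Icc 0 (departSize U i j), ∑ s with Starts s i j, B s β = β
  comp_eq : ∀ s i j, Starts s i j → ∀ᵐ t : ℝ, B s (departCount U i j t) = U s t

/-! ### Traffic flow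

In the following `X s i j t` is the number of drivers of the subgroup `s` that have exited from the
arc from `i` to `j` within time `t`. -/

open Classical in
/-- Number of drivers of the subgroup `s` that have entered the arc from `i` to `j` within time `t`:
those that have exited from the preceding arc of the path, or those that have started, if the arc
is the first one. -/
noncomputable def entered (U : M.DriverClass → ℝ → ℝ) (X : M.DriverClass → V → V → ℝ → ℝ)
    (s : M.DriverClass) (i j : V) (t : ℝ) : ℝ :=
  (∑ l : V, if Uses s l i ∧ Uses s i j then X s l i t else 0) +
    if Starts s i j then U s t else 0

/-- Number of drivers that have entered the arc from `i` to `j` within time `t`. -/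
noncomputable def totalEntered (U : M.DriverClass → ℝ → ℝ) (X : M.DriverClass → V → V → ℝ → ℝ)
    (i j : V) (t : ℝ) : ℝ :=
  ∑ s, entered U X s i j t

open Classical in
/-- Number of drivers in transit (not departing from `i`) that have entered the arc from `i` to `j`
within time `t`. -/
noncomputable def transitEntered (U : M.DriverClass → ℝ → ℝ)
    (X : M.DriverClass → V → V → ℝ → ℝ) (i j : V) (t : ℝ) : ℝ :=
  ∑ s with M.origin s.1 ≠ i, entered U X s i j t

/-- Number of drivers that have exited from the arc from `i` to `j` within time `t`. -/
noncomputable def totalExited (X : M.DriverClass → V → V → ℝ → ℝ) (i j : V) (t : ℝ) : ℝ :=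
  ∑ s, X s i j t

/-- `X` is the traffic flow on the whole network for the departure distributions `U` and the
prioritizing functions `B`. The exit count of every arc is given by the Lax-Hopf formula. Drivers
that exit at time `t` entered at a time `τ` with `totalEntered (τ-) ≤ totalExited t ≤
totalEntered (τ+)`; drivers in transit are served first-come first-serve, and drivers that start
their journey on the arc are ordered by `B`. (If no driver is in transit, `transitEntered` is `0`.)
The entry time need not be unique, but any two choices give the same right-hand sides. -/
structure IsFlow (U B : M.DriverClass → ℝ → ℝ) (X : M.DriverClass → V → V → ℝ → ℝ) : Prop where
  mono : ∀ s i j, Monotone (X s i j)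
  tendsto_atBot : ∀ s i j, Tendsto (X s i j) atBot (𝓝 0)
  not_uses : ∀ s i j, ¬ Uses s i j → ∀ t, X s i j t = 0
  lax : ∀ i j, M.Viable i j → ∀ t,
    totalExited X i j t = M.laxHopf i j (totalEntered U X i j) t
  transit : ∀ s i j, Uses s i j → M.origin s.1 ≠ i → ∀ t τ,
    IsEntryTime (totalEntered U X i j) (totalExited X i j t) τ →
      X s i j t = entered U X s i j τ
  start : ∀ s i j, Starts s i j → ∀ t τ,
    IsEntryTime (totalEntered U X i j) (totalExited X i j t) τ →
      X s i j t = B s (totalExited X i j t - transitEntered U X i j τ)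

open Classical in
/-- Number of drivers of the subgroup `s` that have arrived at destination within time `t`. -/
noncomputable def arrived (X : M.DriverClass → V → V → ℝ → ℝ) (s : M.DriverClass) (t : ℝ) : ℝ :=
  ∑ i : V, if Uses s i (M.dest s.1) then X s i (M.dest s.1) t else 0

/-- The sum of the departure and arrival costs of all drivers. -/
noncomputable def totalCost (U : M.DriverClass → ℝ → ℝ) (X : M.DriverClass → V → V → ℝ → ℝ) :
    EReal :=
  ∑ s, extIntegral
    (fun β => M.departCost s.1 (driverTime (U s) β) + M.arriveCost s.1 (driverTime (arrived X s) β))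
    (size U s)

end TrafficModel

/-! The proof is the direct method of the calculus of variations: take a minimizing sequence of
departures, priorities and flows, extract a limit, show that the limit is again feasible, and show
that the cost does not increase in the limit.

Compactness. No driver arrives before departing, so each pays at least `φ(τ) + ψ(τ)`, with `τ` the
departure time. This is coercive, hence bounded cost keeps mass from escaping to `±∞` (`tight_left`,
`tight_right`). Exit counts are Lipschitz with a common bound on the fluxes as constant. Priorities
are 1-Lipschitz, because they are nondecreasing and sum to the identity. Departures are merely
monotone and converge weakly, by Helly's theorem. One diagonal extraction handles all of them
(`exists_flowLimit`).

Closedness. Limit departures may jump, so only weak convergence of entry counts is available. Two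
facts suffice. Infimal convolution with a Lipschitz, coercive kernel turns weak into pointwise
convergence (`WeakLim.eq_infConv`), which passes the Lax-Hopf formula to the limit. Counts of
drivers in transit stay continuous; their values at entry times converge even if the entry times
themselves do not (`WeakLim.tendsto_entry`). Together with the equicontinuity of the priorities this
gives `FlowLimit.flow`. Atoms of departures cause no loss of information, since the limiting
priority functions still record the order inside an atom.

Lower semicontinuity. For almost every driver label, departure times in the sequence are eventually
at most slightly later than in the limit, and arrival times at most slightly earlier. Since
departure costs decrease and arrival costs increase in time, Fatou's lemma applies
(`FlowLimit.shiftedCost_le_liminf`). A constant `m` added to every driver's cost makes the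
integrands nonnegative; the number of drivers is fixed, so this only shifts the total
(`totalCost_eq`).

Finite competitor. For continuous departures that vanish before time `0`, a flow is built step by
step in time, using the positive minimal travel time of the arcs (`exists_propagate_eq`). Constant
departure rates on one path per group then give finite cost (`exists_feasible`). -/

/-! ### Travel kernels and infimal convolution -/

/-- The properties of `x ↦ L * g⋆(x / L)` used for the analysis of a single arc: `a` is the minimal
travel time and `Λ` the maximal flux. -/
structure IsTravelKernel (h : ℝ → ℝ) (a Λ : ℝ) : Prop where
  delay_pos : 0 < a
  rate_nonneg : 0 ≤ Λ
  nonneg : ∀ x, 0 ≤ h x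
  mono : Monotone h
  lip : ∀ x y, x ≤ y → h y ≤ h x + Λ * (y - x)
  zero : ∀ x, x ≤ a → h x = 0
  tendsto : Tendsto h atTop atTop

/-- The infimal convolution of `f` and `h`. -/
noncomputable def infConv (f h : ℝ → ℝ) (t : ℝ) : ℝ := ⨅ τ : ℝ, (f τ + h (t - τ))

section Kernel

variable {f h : ℝ → ℝ} {a Λ : ℝ}

theorem infConv_bddBelow (hf : ∀ t, 0 ≤ f t) (hh : IsTravelKernel h a Λ) (t : ℝ) :
    BddBelow (range fun τ => f τ + h (t - τ)) :=
  ⟨0, by rintro _ ⟨τ, rfl⟩; exact add_nonneg (hf _) (hh.nonneg _)⟩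

theorem infConv_le (hf : ∀ t, 0 ≤ f t) (hh : IsTravelKernel h a Λ) (t τ : ℝ) :
    infConv f h t ≤ f τ + h (t - τ) :=
  ciInf_le (infConv_bddBelow hf hh t) τ

theorem le_infConv {t c : ℝ} (H : ∀ τ, c ≤ f τ + h (t - τ)) : c ≤ infConv f h t :=
  le_ciInf H

theorem infConv_nonneg (hf : ∀ t, 0 ≤ f t) (hh : IsTravelKernel h a Λ) (t : ℝ) :
    0 ≤ infConv f h t :=
  le_infConv fun τ => add_nonneg (hf τ) (hh.nonneg _)

theorem infConv_le_delay (hf : ∀ t, 0 ≤ f t) (hh : IsTravelKernel h a Λ) (t : ℝ) :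
    infConv f h t ≤ f (t - a) := by
  have := infConv_le hf hh t (t - a)
  rwa [hh.zero _ (by linarith), add_zero] at this

theorem infConv_le_self (hf : ∀ t, 0 ≤ f t) (hh : IsTravelKernel h a Λ) (t : ℝ) :
    infConv f h t ≤ f t := by
  have := infConv_le hf hh t t
  rwa [hh.zero _ (by linarith [hh.delay_pos]), add_zero] at this

theorem infConv_mono (hf : ∀ t, 0 ≤ f t) (hh : IsTravelKernel h a Λ) : Monotone (infConv f h) :=
  fun s t hst => le_infConv fun τ => (infConv_le hf hh s τ).trans
    (by gcongr; exact hh.mono (by linarith))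

theorem infConv_lip (hf : ∀ t, 0 ≤ f t) (hh : IsTravelKernel h a Λ) {s t : ℝ} (hst : s ≤ t) :
    infConv f h t ≤ infConv f h s + Λ * (t - s) := by
  rw [← sub_le_iff_le_add]
  refine le_infConv fun τ => ?_
  have h1 := infConv_le hf hh t τ
  have h2 := hh.lip (s - τ) (t - τ) (by linarith)
  have h3 : t - τ - (s - τ) = t - s := by ring
  rw [h3] at h2
  linarith

/-- After a clearing time `C` everybody has left: a minimizing `τ ≥ t` already pays `f t`, while for
`τ ≤ t` the kernel alone exceeds the total mass `W`. -/
theorem le_infConv_add {W C : ℝ} (hm : Monotone f) (hf : ∀ t, 0 ≤ f t) (hW : ∀ t, f t ≤ W)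
    (hh : IsTravelKernel h a Λ) (hC : W ≤ h C) (t : ℝ) : f t ≤ infConv f h (t + C) := by
  refine le_infConv fun τ => ?_
  rcases le_total t τ with hτ | hτ
  · linarith [hm hτ, hh.nonneg (t + C - τ)]
  · linarith [hf τ, hW t, hh.mono (show C ≤ t + C - τ by linarith)]

/-- Causality with delay: `h` vanishes up to `a`, so for a monotone function no `τ > t - a` does
better than `t - a`. This drives the step-by-step construction of flows. -/
theorem infConv_le_of_eq_before {g : ℝ → ℝ} {T t : ℝ} (hf : ∀ t, 0 ≤ f t) (hg : Monotone g)
    (hh : IsTravelKernel h a Λ) (hfg : ∀ x ≤ T, f x = g x) (ht : t ≤ T + a) :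
    infConv f h t ≤ infConv g h t := by
  refine le_infConv fun τ => ?_
  rcases le_total τ (t - a) with hτ | hτ
  · rw [← hfg τ (by linarith)]
    exact infConv_le hf hh t τ
  · have h1 := infConv_le_delay hf hh t
    rw [hfg _ (by linarith)] at h1
    linarith [hg hτ, hh.nonneg (t - τ)]

end Kernel

/-! ### Entry times -/

theorem isEntryTime_iff {f : ℝ → ℝ} (hf : Monotone f) {c τ : ℝ} :
    IsEntryTime f c τ ↔ (∀ x < τ, f x ≤ c) ∧ ∀ x > τ, c ≤ f x := by
  refine ⟨fun ⟨h1, h2⟩ => ⟨fun x hx => (hf.le_leftLim hx).trans h1,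
    fun x hx => h2.trans (hf.rightLim_le hx)⟩, fun ⟨h1, h2⟩ => ⟨?_, ?_⟩⟩
  · exact le_of_tendsto (hf.tendsto_leftLim τ)
      (eventually_nhdsWithin_of_forall fun x hx => h1 x hx)
  · exact ge_of_tendsto (hf.tendsto_rightLim τ)
      (eventually_nhdsWithin_of_forall fun x hx => h2 x hx)

theorem exists_isEntryTime {f h : ℝ → ℝ} {a Λ : ℝ} (hm : Monotone f)
    (h0 : Tendsto f atBot (𝓝 0)) (hh : IsTravelKernel h a Λ) (t : ℝ) :
    ∃ τ, IsEntryTime f (infConv f h t) τ := by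
  have hf : ∀ t, 0 ≤ f t := fun t => hm.le_of_tendsto h0 t
  simp only [isEntryTime_iff hm]
  set c := infConv f h t with hc
  have hct : c ≤ f t := infConv_le_self hf hh t
  by_cases hb : BddBelow {τ | c ≤ f τ}
  · refine ⟨sInf {τ | c ≤ f τ}, fun x hx => ?_, fun x hx => ?_⟩
    · by_contra! hcon
      exact absurd (csInf_le hb (show x ∈ {τ | c ≤ f τ} from hcon.le)) (not_le.2 hx)
    · obtain ⟨y, hy, hyx⟩ := exists_lt_of_csInf_lt ⟨t, hct⟩ hx
      exact le_trans hy (hm hyx.le)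
  · have hall : ∀ τ, c ≤ f τ := by
      intro τ
      rw [not_bddBelow_iff] at hb
      obtain ⟨y, hy, hyx⟩ := hb τ
      exact le_trans hy (hm hyx.le)
    have hc0 : c = 0 :=
      le_antisymm (ge_of_tendsto' h0 hall) (infConv_nonneg hf hh t)
    obtain ⟨R, hR⟩ := (hh.tendsto.eventually (eventually_ge_atTop 1)).exists
    have hex : ∃ τ, f τ = 0 := by
      by_contra! hne
      have hpos : 0 < f (t - R) := lt_of_le_of_ne (hf _) (Ne.symm (hne _))
      have : min 1 (f (t - R)) ≤ c := by
        refine le_infConv fun τ => ?_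
        rcases le_total τ (t - R) with hτ | hτ
        · exact (min_le_left _ _).trans (by linarith [hf τ, hh.mono (show R ≤ t - τ by linarith)])
        · exact (min_le_right _ _).trans (by linarith [hm hτ, hh.nonneg (t - τ)])
      have h2 : 0 < min 1 (f (t - R)) := lt_min one_pos hpos
      linarith
    obtain ⟨τ, hτ⟩ := hex
    exact ⟨τ, fun x hx => by linarith [hm hx.le], fun x _ => hall x⟩

/-- An entry time for a level that is reached at time `t` can be chosen to be at most `t`. -/
theorem IsEntryTime.exists_le {f : ℝ → ℝ} (hm : Monotone f) {c τ t : ℝ} (hτ : IsEntryTime f c τ)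
    (h : c ≤ f t) : ∃ τ' ≤ t, IsEntryTime f c τ' := by
  rcases le_or_gt τ t with hle | hlt
  · exact ⟨τ, hle, hτ⟩
  · refine ⟨t, le_rfl, (isEntryTime_iff hm).2 ⟨fun x hx => ?_, fun x hx => h.trans (hm hx.le)⟩⟩
    exact ((isEntryTime_iff hm).1 hτ).1 x (hx.trans hlt)

theorem IsEntryTime.exists_ge {f : ℝ → ℝ} (hm : Monotone f) {c τ t : ℝ} (hτ : IsEntryTime f c τ)
    (h : f t ≤ c) : ∃ τ' ≥ t, IsEntryTime f c τ' := by
  rcases le_or_gt t τ with hle | hlt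
  · exact ⟨τ, hle, hτ⟩
  · refine ⟨t, le_rfl, (isEntryTime_iff hm).2 ⟨fun x hx => (hm hx.le).trans h, fun x hx => ?_⟩⟩
    exact ((isEntryTime_iff hm).1 hτ).2 x (hlt.trans hx)

/-- If `e` is a continuous nondecreasing part of `f`, the value of `e` at an entry time for `f` is
controlled by the values of `e` and `f` at any other time. -/
theorem IsEntryTime.le_add {f e : ℝ → ℝ} (hf : Monotone f) (he : Monotone e) (hec : Continuous e)
    (hfe : Monotone fun x => f x - e x) {c τ : ℝ} (hτ : IsEntryTime f c τ) (x : ℝ) :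
    e τ ≤ e x + max 0 (c - f x) := by
  rcases le_or_gt τ x with h | h
  · linarith [he h, le_max_left 0 (c - f x)]
  · have h1 : ∀ y ∈ Ioo x τ, e y ≤ e x + (c - f x) := fun y hy => by
      have h2 := hfe hy.1.le
      have h3 := ((isEntryTime_iff hf).1 hτ).1 y hy.2
      simp only at h2
      linarith
    have h4 : e τ ≤ e x + (c - f x) :=
      le_of_tendsto (hec.continuousWithinAt (s := Iio τ) (x := τ)) (by
        filter_upwards [Ioo_mem_nhdsLT h] with y hy using h1 y hy)
    linarith [le_max_right 0 (c - f x)]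

/-- The mirror image of `IsEntryTime.le_add`: between the two times `e` cannot grow more than `f`
does. -/
theorem IsEntryTime.sub_le {f e : ℝ → ℝ} (hf : Monotone f) (he : Monotone e) (hec : Continuous e)
    (hfe : Monotone fun x => f x - e x) {c τ : ℝ} (hτ : IsEntryTime f c τ) (x : ℝ) :
    e x - max 0 (f x - c) ≤ e τ := by
  rcases le_or_gt x τ with h | h
  · linarith [he h, le_max_left 0 (f x - c)]
  · have h1 : ∀ y ∈ Ioo τ x, e x - (f x - c) ≤ e y := fun y hy => by
      have h2 := hfe hy.2.le
      have h3 := ((isEntryTime_iff hf).1 hτ).2 y hy.1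
      simp only at h2
      linarith
    have h4 : e x - (f x - c) ≤ e τ :=
      ge_of_tendsto (hec.continuousWithinAt (s := Ioi τ) (x := τ)) (by
        filter_upwards [Ioo_mem_nhdsGT h] with y hy using h1 y hy)
    linarith [le_max_right 0 (f x - c)]

/-! ### Weak convergence of nondecreasing functions -/

/-- Weak convergence of a sequence of nondecreasing functions, expressed by inequalities. -/
def WeakLim (u : ℕ → ℝ → ℝ) (U : ℝ → ℝ) : Prop :=
  ∀ a b, a < b → ∀ ε > 0, ∀ᶠ N in atTop, u N a ≤ U b + ε ∧ U a ≤ u N b + ε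

theorem WeakLim.of_tendsto {u : ℕ → ℝ → ℝ} {U : ℝ → ℝ} (hu : ∀ N, Monotone (u N))
    (h : ∀ t, Tendsto (fun N => u N t) atTop (𝓝 (U t))) : WeakLim u U := by
  intro a b hab ε hε
  filter_upwards [(h b).eventually_le_const (show U b < U b + ε by linarith),
    (h a).eventually_const_le (show U a - ε < U a by linarith)] with N h1 h2
  exact ⟨(hu N hab.le).trans h1, by linarith [hu N hab.le]⟩

theorem WeakLim.sum {ι : Type*} (s : Finset ι) {u : ι → ℕ → ℝ → ℝ} {U : ι → ℝ → ℝ}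
    (h : ∀ i ∈ s, WeakLim (u i) (U i)) :
    WeakLim (fun N t => ∑ i ∈ s, u i N t) fun t => ∑ i ∈ s, U i t := by
  intro a b hab ε hε
  have hε' : 0 < ε / (s.card + 1) := by positivity
  have hle : ∑ _i ∈ s, ε / (s.card + 1) ≤ ε := by
    rw [Finset.sum_const, nsmul_eq_mul, mul_div_assoc', div_le_iff₀ (by positivity)]
    nlinarith
  filter_upwards [(Finset.eventually_all s).2 fun i hi => h i hi a b hab _ hε'] with N hN
  constructor
  · calc _ ≤ ∑ i ∈ s, (U i b + ε / (s.card + 1)) := Finset.sum_le_sum fun i hi => (hN i hi).1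
      _ ≤ _ := by rw [Finset.sum_add_distrib]; linarith
  · calc _ ≤ ∑ i ∈ s, (u i N b + ε / (s.card + 1)) := Finset.sum_le_sum fun i hi => (hN i hi).2
      _ ≤ _ := by rw [Finset.sum_add_distrib]; linarith

/-- Squeeze `u N t` between values of `U` at nearby points on both sides of `t`. -/
theorem WeakLim.tendsto_of_continuousAt {u : ℕ → ℝ → ℝ} {U : ℝ → ℝ} (h : WeakLim u U) {t : ℝ}
    (ht : ContinuousAt U t) : Tendsto (fun N => u N t) atTop (𝓝 (U t)) := by
  rw [Metric.tendsto_atTop']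
  intro ε hε
  obtain ⟨δ, hδ, hU⟩ := Metric.continuousAt_iff.1 ht (ε / 2) (by linarith)
  have h1 := hU (show dist (t + δ / 2) t < δ by
    rw [Real.dist_eq, add_sub_cancel_left, abs_of_pos (by linarith)]; linarith)
  have h2 := hU (show dist (t - δ / 2) t < δ by
    rw [Real.dist_eq, sub_sub_cancel_left, abs_neg, abs_of_pos (by linarith)]; linarith)
  rw [Real.dist_eq, abs_lt] at h1 h2
  have h3 := h t (t + δ / 2) (by linarith) (ε / 3) (by linarith)
  have h4 := h (t - δ / 2) t (by linarith) (ε / 3) (by linarith)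
  obtain ⟨N, hN⟩ := eventually_atTop.1 (h3.and h4)
  refine ⟨N, fun K hK => ?_⟩
  have h5 := hN K hK.le
  rw [Real.dist_eq, abs_lt]
  constructor <;> linarith

/-- Infimal convolution with a travel kernel turns weak into pointwise convergence. -/
theorem WeakLim.eq_infConv {u : ℕ → ℝ → ℝ} {U h : ℝ → ℝ} {a Λ : ℝ} (hw : WeakLim u U)
    (hu : ∀ N, Monotone (u N)) (hu0 : ∀ N t, 0 ≤ u N t) (hU0 : ∀ t, 0 ≤ U t)
    (hh : IsTravelKernel h a Λ) {t c : ℝ}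
    (hc : Tendsto (fun N => infConv (u N) h t) atTop (𝓝 c)) : c = infConv U h t := by
  have hcont : ∀ x y, x ≤ y → h (t - x) ≤ h (t - y) + Λ * (y - x) := fun x y hxy => by
    have := hh.lip (t - y) (t - x) (by linarith)
    rwa [show t - x - (t - y) = y - x by ring] at this
  apply le_antisymm
  · refine le_infConv fun τ => le_of_forall_pos_le_add fun ε hε => ?_
    -- Weak convergence bounds `u N` only strictly to the left of `τ`; moving by `δ` costs at most
    -- `Λ * δ ≤ ε / 2` in the kernel. The `+ 1` allows for `Λ = 0`.
    set δ := ε / (2 * (Λ + 1)) with hδ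
    have hΛ := hh.rate_nonneg
    have hδ0 : 0 < δ := by positivity
    have hδ1 : Λ * δ ≤ ε / 2 := by
      rw [hδ, mul_div_assoc', div_le_iff₀ (by positivity)]; nlinarith
    refine le_of_tendsto hc ?_
    filter_upwards [hw (τ - δ) τ (by linarith) (ε / 2) (by linarith)] with N hN
    have h1 := infConv_le (hu0 N) hh t (τ - δ)
    have h2 := hcont (τ - δ) τ (by linarith)
    rw [show τ - (τ - δ) = δ by ring] at h2
    linarith [hN.1]
  · set W := infConv U h t + 1
    obtain ⟨R, hR⟩ := (hh.tendsto.eventually (eventually_ge_atTop W)).exists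
    obtain hlt | hge := lt_or_ge c (infConv U h t)
    swap
    · exact hge
    exfalso
    set ε := (infConv U h t - c) / 4 with hε
    have hε0 : 0 < ε := by rw [hε]; linarith
    -- Near-minimizers lie in a fixed compact interval: before `t - R` the kernel is too large, and
    -- any point after `t` may be replaced by `t`, where the kernel is zero.
    have hex : ∀ᶠ N in atTop, ∃ τ ∈ Icc (t - R) t, u N τ + h (t - τ) < c + ε := by
      filter_upwards [hc.eventually_lt_const (show c < c + ε by linarith)] with N hN
      obtain ⟨τ, hτ⟩ := exists_lt_of_ciInf_lt hN
      have hτR : t - R ≤ τ := by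
        by_contra! hcon
        have := hh.mono (show R ≤ t - τ by linarith)
        linarith [hu0 N τ]
      rcases le_total τ t with hle | hle
      · exact ⟨τ, ⟨hτR, hle⟩, hτ⟩
      · refine ⟨t, ⟨?_, le_rfl⟩, ?_⟩
        · by_contra! hcon
          have h1 : h R = 0 := hh.zero _ (by linarith [hh.delay_pos])
          have h2 := infConv_nonneg hU0 hh t
          linarith
        · rw [sub_self, hh.zero 0 hh.delay_pos.le]
          linarith [hu N hle, hh.nonneg (t - τ)]
    obtain ⟨N0, hN0⟩ := eventually_atTop.1 hex
    choose! τ hτ hτ' using hN0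
    obtain ⟨τ₀, -, φ, hφ, hlim⟩ := (isCompact_Icc (a := t - R) (b := t)).tendsto_subseq
      (x := fun N => τ (N0 + N)) fun N => hτ _ (by omega)
    set δ := ε / (2 * (Λ + 1)) with hδ
    have hΛ := hh.rate_nonneg
    have hδ0 : 0 < δ := by positivity
    have hδ1 : Λ * δ ≤ ε / 2 := by
      rw [hδ, mul_div_assoc', div_le_iff₀ (by positivity)]; nlinarith
    have hshift : Tendsto (fun N => N0 + φ N) atTop atTop :=
      tendsto_atTop_mono (fun N => (hφ.le_apply (x := N)).trans (Nat.le_add_left _ _)) tendsto_id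
    -- The limit `U` is tested at `τ₀ - δ`, to the left of all late near-minimizers, so monotonicity
    -- and weak convergence give `U (τ₀ - δ)` as a lower bound up to `ε`.
    have hev := hshift.eventually (hw (τ₀ - δ) (τ₀ - δ / 2) (by linarith) ε hε0)
    have hev2 := hlim.eventually (Ioo_mem_nhds (show τ₀ - δ / 2 < τ₀ by linarith)
      (show τ₀ < τ₀ + δ by linarith))
    obtain ⟨N, h1, h2⟩ := (hev.and hev2).exists
    simp only [Function.comp_apply] at h2
    have h3 := hτ' (N0 + φ N) (by omega)
    have h4 := hu (N0 + φ N) h2.1.le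
    have h5 := infConv_le hU0 hh t (τ₀ - δ)
    have h6 := hcont (τ₀ - δ) (τ (N0 + φ N)) (by linarith)
    have h7 : Λ * (τ (N0 + φ N) - (τ₀ - δ)) ≤ Λ * (2 * δ) := by gcongr; linarith
    linarith [h1.2]

/-- Values of a continuous part of `u N` at entry times converge to the value of the limit at any
entry time of the limit. -/
theorem WeakLim.tendsto_entry {u e : ℕ → ℝ → ℝ} {U E : ℝ → ℝ} (hw : WeakLim u U)
    (hu : ∀ N, Monotone (u N)) (he : ∀ N, Monotone (e N)) (hec : ∀ N, Continuous (e N))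
    (hue : ∀ N, Monotone fun x => u N x - e N x) (hU : Monotone U) (hEc : Continuous E)
    (hlim : ∀ t, Tendsto (fun N => e N t) atTop (𝓝 (E t)))
    {c : ℕ → ℝ} {c₀ : ℝ} (hc : Tendsto c atTop (𝓝 c₀)) {τ : ℕ → ℝ} {τ₀ : ℝ}
    (hτ : ∀ N, IsEntryTime (u N) (c N) (τ N)) (hτ₀ : IsEntryTime U c₀ τ₀) :
    Tendsto (fun N => e N (τ N)) atTop (𝓝 (E τ₀)) := by
  have hI := (isEntryTime_iff hU).1 hτ₀
  rw [Metric.tendsto_atTop']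
  intro ε hε
  obtain ⟨δ, hδ, hE⟩ := Metric.continuousAt_iff.1 hEc.continuousAt (ε / 4) (by linarith)
  have h1 := hE (show dist (τ₀ + δ / 2) τ₀ < δ by
    rw [Real.dist_eq, add_sub_cancel_left, abs_of_pos (by linarith)]; linarith)
  have h2 := hE (show dist (τ₀ - δ / 2) τ₀ < δ by
    rw [Real.dist_eq, sub_sub_cancel_left, abs_neg, abs_of_pos (by linarith)]; linarith)
  rw [Real.dist_eq, abs_lt] at h1 h2
  have h3 := hw (τ₀ + δ / 4) (τ₀ + δ / 2) (by linarith) (ε / 4) (by linarith)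
  have h4 := hw (τ₀ - δ / 2) (τ₀ - δ / 4) (by linarith) (ε / 4) (by linarith)
  have h5 := Metric.tendsto_nhds.1 hc (ε / 4) (by linarith)
  have h6 := Metric.tendsto_nhds.1 (hlim (τ₀ + δ / 2)) (ε / 8) (by linarith)
  have h7 := Metric.tendsto_nhds.1 (hlim (τ₀ - δ / 2)) (ε / 8) (by linarith)
  obtain ⟨N, hN⟩ := eventually_atTop.1 (h3.and (h4.and (h5.and (h6.and h7))))
  refine ⟨N, fun K hK => ?_⟩
  obtain ⟨h3, h4, h5, h6, h7⟩ := hN K hK.le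
  rw [Real.dist_eq, abs_lt] at h5 h6 h7
  -- The entry times `τ K` need not converge, for instance when `U` is flat. Comparing with the
  -- fixed points `τ₀ ± δ / 2`, where `u K` has nearly crossed the level, avoids them.
  have h8 := (hτ K).le_add (hu K) (he K) (hec K) (hue K) (τ₀ + δ / 2)
  have h9 := (hτ K).sub_le (hu K) (he K) (hec K) (hue K) (τ₀ - δ / 2)
  have h10 : max 0 (c K - u K (τ₀ + δ / 2)) ≤ ε / 2 := max_le (by linarith) (by
    linarith [hI.2 (τ₀ + δ / 4) (by linarith), h3.2])
  have h11 : max 0 (u K (τ₀ - δ / 2) - c K) ≤ ε / 2 := max_le (by linarith) (by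
    linarith [hI.1 (τ₀ - δ / 4) (by linarith), h4.1])
  rw [Real.dist_eq, abs_lt]
  constructor <;> linarith

namespace TrafficModel

variable {V : Type*} {n : ℕ} {M : TrafficModel V n}

/-! ### The kernel of a viable arc -/

/-- The function `x ↦ L * g⋆(x / L)` in the Lax-Hopf formula. -/
noncomputable def kernel (M : TrafficModel V n) (i j : V) (x : ℝ) : ℝ :=
  M.length i j * M.legendre i j (x / M.length i j)

theorem laxHopf_eq_infConv (i j : V) (f : ℝ → ℝ) (t : ℝ) :
    M.laxHopf i j f t = infConv f (M.kernel i j) t := rfl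

theorem flux_le_maxFlux {i j : V} (hM : M.FluxAssumption) (hv : M.Viable i j)
    {ρ : ℝ} (hρ : ρ ∈ Icc 0 (M.maxDensity i j)) :
    M.flux i j ρ ≤ M.maxFlux i j :=
  le_csSup (isCompact_Icc.image_of_continuousOn (hM.flux_cont i j hv)).bddAbove
    (mem_image_of_mem _ hρ)

theorem critDensity_mem {i j : V} (hM : M.FluxAssumption) (hv : M.Viable i j) :
    M.critDensity i j ∈ {ρ ∈ Icc 0 (M.maxDensity i j) | M.flux i j ρ = M.maxFlux i j} := by
  have hne : (Icc 0 (M.maxDensity i j)).Nonempty :=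
    ⟨0, le_rfl, (hM.maxDensity_pos i j hv).le⟩
  have hcl : IsClosed {ρ ∈ Icc 0 (M.maxDensity i j) | M.flux i j ρ = M.maxFlux i j} :=
    (hM.flux_cont i j hv).preimage_isClosed_of_isClosed isClosed_Icc
      (isClosed_singleton (x := M.maxFlux i j))
  refine hcl.csInf_mem ?_ ⟨0, fun ρ hρ => hρ.1.1⟩
  obtain ⟨ρ, hρ, h⟩ := isCompact_Icc.exists_sSup_image_eq hne (hM.flux_cont i j hv)
  exact ⟨ρ, hρ, h.symm⟩

theorem maxFlux_pos {i j : V} (hM : M.FluxAssumption) (hv : M.Viable i j) :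
    0 < M.maxFlux i j := by
  have hpos := hM.maxDensity_pos i j hv
  have h0 : (0 : ℝ) ∈ Icc 0 (M.maxDensity i j) := ⟨le_rfl, hpos.le⟩
  have h1 : ∀ᶠ ρ in 𝓝[Icc 0 (M.maxDensity i j)] 0, 0 < M.speed i j ρ :=
    (hM.speed_cont i j hv 0 h0).eventually (eventually_gt_nhds hv)
  have h2 : ∀ᶠ ρ in 𝓝[>] (0 : ℝ), 0 < M.speed i j ρ :=
    (nhdsWithin_le_iff.2 (Icc_mem_nhdsGT hpos)) h1
  obtain ⟨ρ, h3, h4, h5⟩ := (h2.and (Ioo_mem_nhdsGT hpos)).exists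
  exact (mul_pos h4 h3).trans_le (flux_le_maxFlux hM hv ⟨h4.le, h5.le⟩)

theorem invFlux_mem {i j : V} (hM : M.FluxAssumption) (hv : M.Viable i j)
    {u : ℝ} (hu : u ∈ Icc 0 (M.maxFlux i j)) :
    M.invFlux i j u ∈ Icc 0 (M.critDensity i j) ∧ M.flux i j (M.invFlux i j u) = u := by
  obtain ⟨⟨h1, h2⟩, h3⟩ := critDensity_mem hM hv
  refine Function.invFunOn_pos ?_
  have := intermediate_value_Icc h1
    ((hM.flux_cont i j hv).mono (Icc_subset_Icc_right h2))
  rw [hM.flux_zero i j hv, h3] at this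
  exact this hu

/-- No car is faster than the speed at zero density. This is what makes the kernel vanish up to the
free travel time. -/
theorem le_speed_mul_invFlux {i j : V} (hM : M.FluxAssumption) (hv : M.Viable i j)
    {u : ℝ} (hu : u ∈ Icc 0 (M.maxFlux i j)) :
    u ≤ M.speed i j 0 * M.invFlux i j u := by
  obtain ⟨⟨h1, h2⟩, h3⟩ := invFlux_mem hM hv hu
  obtain ⟨⟨-, h5⟩, -⟩ := critDensity_mem hM hv
  have h6 := hM.speed_anti i j hv ⟨le_rfl, (hM.maxDensity_pos i j hv).le⟩ ⟨h1, h2.trans h5⟩ h1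
  calc u = M.invFlux i j u * M.speed i j (M.invFlux i j u) := h3.symm
    _ ≤ M.invFlux i j u * M.speed i j 0 := by gcongr
    _ = _ := mul_comm _ _

/-- Concavity puts the flux above the chord from `0` to the critical density, where the flux is
positive. Hence `0` is its only zero on the increasing branch, and the choice made by
`Function.invFunOn` is forced. -/
theorem invFlux_zero {i j : V} (hM : M.FluxAssumption) (hv : M.Viable i j) :
    M.invFlux i j 0 = 0 := by
  have hF := maxFlux_pos hM hv
  obtain ⟨⟨h1, h2⟩, h3⟩ := invFlux_mem hM hv (u := 0) ⟨le_rfl, hF.le⟩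
  obtain ⟨⟨h4, h5⟩, h6⟩ := critDensity_mem hM hv
  set ρ := M.invFlux i j 0
  set ρ' := M.critDensity i j
  have hρ' : 0 < ρ' := by
    refine lt_of_le_of_ne h4 fun h => ?_
    rw [← h, hM.flux_zero i j hv] at h6
    exact hF.ne h6
  have hconc := (hM.flux_concave i j hv).2 (⟨le_rfl, h4.trans h5⟩ : (0 : ℝ) ∈ Icc 0 _) ⟨h4, h5⟩
    (show 0 ≤ 1 - ρ / ρ' by rw [sub_nonneg]; exact (div_le_one hρ').2 h2)
    (show 0 ≤ ρ / ρ' by positivity) (by ring)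
  rw [smul_zero, zero_add, smul_eq_mul, smul_eq_mul, smul_eq_mul, div_mul_cancel₀ _ hρ'.ne',
    hM.flux_zero i j hv, h3, h6, mul_zero, zero_add] at hconc
  by_contra hne
  have : 0 < ρ := lt_of_le_of_ne h1 (Ne.symm hne)
  have : 0 < ρ / ρ' * M.maxFlux i j := by positivity
  linarith

theorem legendre_set_bdd {i j : V} (hM : M.FluxAssumption) (hv : M.Viable i j)
    (p : ℝ) :
    BddAbove ((fun u => p * u - M.invFlux i j u) '' Icc 0 (M.maxFlux i j)) := by
  refine ⟨|p| * M.maxFlux i j, ?_⟩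
  rintro _ ⟨u, hu, rfl⟩
  have h1 := (invFlux_mem hM hv hu).1.1
  have h2 : p * u ≤ |p| * M.maxFlux i j :=
    mul_le_mul (le_abs_self p) hu.2 hu.1 (abs_nonneg p)
  simp only
  linarith

theorem le_legendre {i j : V} (hM : M.FluxAssumption) (hv : M.Viable i j)
    (p : ℝ) {u : ℝ} (hu : u ∈ Icc 0 (M.maxFlux i j)) :
    p * u - M.invFlux i j u ≤ M.legendre i j p :=
  le_csSup (legendre_set_bdd hM hv p) (mem_image_of_mem _ hu)

theorem legendre_le {i j : V} {p c : ℝ} (hF : 0 ≤ M.maxFlux i j)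
    (H : ∀ u ∈ Icc 0 (M.maxFlux i j), p * u - M.invFlux i j u ≤ c) : M.legendre i j p ≤ c :=
  csSup_le ((nonempty_Icc.2 hF).image _) (by rintro _ ⟨u, hu, rfl⟩; exact H u hu)

theorem isTravelKernel_kernel {i j : V} (hM : M.FluxAssumption) (hv : M.Viable i j) :
    IsTravelKernel (M.kernel i j) (M.length i j / M.speed i j 0) (M.maxFlux i j) := by
  have hL := hM.length_pos i j hv
  have hF := maxFlux_pos hM hv
  have h0 : (0 : ℝ) ∈ Icc 0 (M.maxFlux i j) := ⟨le_rfl, hF.le⟩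
  have hv0 : 0 < M.speed i j 0 := hv
  have hnn : ∀ p, 0 ≤ M.legendre i j p := fun p => by
    have := le_legendre hM hv p h0
    rwa [invFlux_zero hM hv, mul_zero, sub_zero] at this
  refine ⟨by positivity, hF.le, fun x => mul_nonneg hL.le (hnn _), fun x y hxy => ?_,
    fun x y hxy => ?_, fun x hx => ?_, ?_⟩
  · refine mul_le_mul_of_nonneg_left (legendre_le hF.le fun u hu => ?_) hL.le
    refine le_trans ?_ (le_legendre hM hv _ hu)
    have : x / M.length i j * u ≤ y / M.length i j * u := by
      have := hu.1
      gcongr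
    linarith
  · have h1 : M.legendre i j (y / M.length i j) ≤
        M.legendre i j (x / M.length i j) + (y - x) / M.length i j * M.maxFlux i j := by
      refine legendre_le hF.le fun u hu => ?_
      have h2 := le_legendre hM hv (x / M.length i j) hu
      have h3 : (y - x) / M.length i j * u ≤ (y - x) / M.length i j * M.maxFlux i j :=
        mul_le_mul_of_nonneg_left hu.2 (div_nonneg (by linarith) hL.le)
      rw [sub_div] at h3 ⊢
      nlinarith
    calc M.kernel i j y ≤ M.length i j * (M.legendre i j (x / M.length i j) +
          (y - x) / M.length i j * M.maxFlux i j) := mul_le_mul_of_nonneg_left h1 hL.le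
      _ = _ := by unfold kernel; field_simp
  · unfold kernel
    have h1 : M.legendre i j (x / M.length i j) = 0 := by
      refine le_antisymm (legendre_le hF.le fun u hu => ?_) (hnn _)
      have h2 := le_speed_mul_invFlux hM hv hu
      have h3 : x / M.length i j ≤ 1 / M.speed i j 0 := by
        rw [div_le_div_iff₀ hL hv0]
        rw [le_div_iff₀ hv0] at hx
        linarith
      have h4 : x / M.length i j * u ≤ 1 / M.speed i j 0 * u :=
        mul_le_mul_of_nonneg_right h3 hu.1
      have h5 : 1 / M.speed i j 0 * u ≤ M.invFlux i j u := by
        rw [one_div_mul_eq_div, div_le_iff₀ hv0]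
        linarith
      linarith
    rw [h1, mul_zero]
  -- Testing the supremum with the maximal flux gives an affine lower bound of positive slope.
  · have h1 : ∀ x, M.maxFlux i j * x - M.length i j * M.invFlux i j (M.maxFlux i j) ≤
        M.kernel i j x := fun x => by
      have h2 := le_legendre hM hv (x / M.length i j) (u := M.maxFlux i j) ⟨hF.le, le_rfl⟩
      calc _ = M.length i j * (x / M.length i j * M.maxFlux i j
              - M.invFlux i j (M.maxFlux i j)) := by field_simp
        _ ≤ _ := mul_le_mul_of_nonneg_left h2 hL.le
    refine tendsto_atTop_mono h1 ?_
    exact tendsto_atTop_add_const_right _ _ (tendsto_id.const_mul_atTop hF)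

/-! ### Paths -/

theorem uses_iff {s : M.DriverClass} {i j : V} :
    Uses s i j ↔ ∃ k : ℕ, s.2.1[k]? = some i ∧ s.2.1[k + 1]? = some j := by
  unfold Uses
  rw [List.infix_iff_getElem?]
  constructor
  · rintro ⟨k, -, h⟩
    refine ⟨k, ?_, ?_⟩
    · simpa using h 0 (by simp)
    · simpa [add_comm] using h 1 (by simp)
  · rintro ⟨k, h1, h2⟩
    refine ⟨k, ?_, ?_⟩
    · have := (List.getElem?_eq_some_iff.1 h2).1
      simp only [List.length_cons, List.length_nil]
      omega
    · intro m hm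
      simp only [List.length_cons, List.length_nil] at hm
      interval_cases m
      · simpa using h1
      · simpa [add_comm] using h2

theorem path_inj {s : M.DriverClass} {k m : ℕ} {i : V} (h1 : s.2.1[k]? = some i)
    (h2 : s.2.1[m]? = some i) : k = m :=
  (List.getElem?_inj (List.getElem?_eq_some_iff.1 h1).1 s.2.2.1).1 (h1.trans h2.symm)

theorem path_zero (s : M.DriverClass) : s.2.1[0]? = some (M.origin s.1) := by
  rw [← List.head?_eq_getElem?]
  exact s.2.2.2.2.2.1

theorem Uses.viable {s : M.DriverClass} {i j : V} (h : Uses s i j) : M.Viable i j := by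
  have := s.2.2.2.1.infix h
  simpa using this

theorem Uses.target_unique {s : M.DriverClass} {i j j' : V} (h : Uses s i j) (h' : Uses s i j') :
    j = j' := by
  obtain ⟨k, h1, h2⟩ := uses_iff.1 h
  obtain ⟨m, h3, h4⟩ := uses_iff.1 h'
  obtain rfl := path_inj h1 h3
  exact Option.some_injective _ (h2.symm.trans h4)

theorem Uses.source_unique {s : M.DriverClass} {i i' j : V} (h : Uses s i j) (h' : Uses s i' j) :
    i = i' := by
  obtain ⟨k, h1, h2⟩ := uses_iff.1 h
  obtain ⟨m, h3, h4⟩ := uses_iff.1 h'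
  obtain rfl : k = m := by simpa using path_inj h2 h4
  exact Option.some_injective _ (h1.symm.trans h3)

theorem not_uses_origin (s : M.DriverClass) (l : V) : ¬ Uses s l (M.origin s.1) := by
  intro h
  obtain ⟨k, -, h2⟩ := uses_iff.1 h
  simpa using path_inj h2 (path_zero s)

theorem exists_starts (s : M.DriverClass) : ∃ j, Starts s (M.origin s.1) j := by
  have hlen : 1 < s.2.1.length := s.2.2.2.2.1
  exact ⟨s.2.1[1], rfl, uses_iff.2 ⟨0, path_zero s, by simp⟩⟩

theorem exists_uses_dest (s : M.DriverClass) : ∃ i, Uses s i (M.dest s.1) := by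
  have hlen : 2 ≤ s.2.1.length := s.2.2.2.2.1
  have hlast : s.2.1.getLast? = some (M.dest s.1) := s.2.2.2.2.2.2
  rw [List.getLast?_eq_getElem?] at hlast
  refine ⟨s.2.1[s.2.1.length - 2], uses_iff.2 ⟨s.2.1.length - 2, by simp, ?_⟩⟩
  rw [← hlast]
  congr 1
  omega

theorem Uses.starts_or {s : M.DriverClass} {i j : V} (h : Uses s i j) :
    Starts s i j ∨ M.origin s.1 ≠ i ∧ ∃ l, Uses s l i := by
  obtain ⟨k, h1, h2⟩ := uses_iff.1 h
  rcases k with _ | k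
  · exact Or.inl ⟨Option.some_injective _ ((path_zero s).symm.trans h1), h⟩
  · refine Or.inr ⟨fun he => ?_, ?_⟩
    · subst he
      simpa using path_inj h1 (path_zero s)
    · have hk : k < s.2.1.length := by
        have := (List.getElem?_eq_some_iff.1 h1).1
        omega
      exact ⟨s.2.1[k], uses_iff.2 ⟨k, by simp, h1⟩⟩

theorem Starts.uses {s : M.DriverClass} {i j : V} (h : Starts s i j) : Uses s i j := h.2

theorem Starts.unique {s : M.DriverClass} {i j i' j' : V} (h : Starts s i j)
    (h' : Starts s i' j') : i = i' ∧ j = j' := by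
  obtain ⟨rfl, h2⟩ := h
  obtain ⟨rfl, h4⟩ := h'
  exact ⟨rfl, h2.target_unique h4⟩

/-- Induction along the arcs of a path. -/
theorem Uses.induction {s : M.DriverClass} {P : V → V → Prop}
    (h0 : ∀ i j, Starts s i j → P i j)
    (h1 : ∀ l i j, Uses s l i → Uses s i j → P l i → P i j) {i j : V} (h : Uses s i j) :
    P i j := by
  obtain ⟨k, hk⟩ := uses_iff.1 h
  induction k generalizing i j with
  | zero => exact h0 _ _ ⟨Option.some_injective _ ((path_zero s).symm.trans hk.1), h⟩
  | succ k ih =>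
    have hk' : k < s.2.1.length := by
      have := (List.getElem?_eq_some_iff.1 hk.1).1
      omega
    have hu : Uses s s.2.1[k] i := uses_iff.2 ⟨k, by simp, hk.1⟩
    exact h1 _ _ _ hu h (ih hu ⟨by simp, hk.1⟩)

/-! ### Entry counts along a path -/

variable [Fintype V] {U : M.DriverClass → ℝ → ℝ} {X : M.DriverClass → V → V → ℝ → ℝ}

theorem entered_of_uses {s : M.DriverClass} {l i j : V} (h1 : Uses s l i) (h2 : Uses s i j) :
    entered U X s i j = X s l i := by
  classical
  funext t
  unfold entered
  rw [Finset.sum_eq_single l, if_pos ⟨h1, h2⟩, if_neg, add_zero]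
  · rintro ⟨rfl, -⟩
    exact not_uses_origin s l h1
  · intro l' _ hl'
    rw [if_neg]
    rintro ⟨h3, -⟩
    exact hl' (h3.source_unique h1)
  · simp

theorem entered_of_starts {s : M.DriverClass} {i j : V} (h : Starts s i j) :
    entered U X s i j = U s := by
  classical
  funext t
  unfold entered
  rw [Finset.sum_eq_zero, if_pos h, zero_add]
  intro l _
  rw [if_neg]
  rintro ⟨h1, -⟩
  obtain ⟨rfl, -⟩ := h
  exact not_uses_origin s l h1

theorem entered_of_not_uses {s : M.DriverClass} {i j : V} (h : ¬ Uses s i j) :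
    entered U X s i j = 0 := by
  classical
  funext t
  unfold entered
  rw [Finset.sum_eq_zero, if_neg fun h' => h h'.uses, zero_add, Pi.zero_apply]
  intro l _
  rw [if_neg fun h' => h h'.2]

/-- To prove a property of `entered`, it suffices to check the three possible values. -/
theorem entered_cases {P : (ℝ → ℝ) → Prop} (s : M.DriverClass) (i j : V)
    (hX : ∀ l, M.origin s.1 ≠ i → Uses s l i → Uses s i j → P (X s l i))
    (hU : Starts s i j → P (U s)) (h0 : P 0) : P (entered U X s i j) := by
  by_cases h : Uses s i j
  · rcases h.starts_or with h' | ⟨h', l, hl⟩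
    · rw [entered_of_starts h']; exact hU h'
    · rw [entered_of_uses hl h]; exact hX l h' hl h
  · rw [entered_of_not_uses h]; exact h0

theorem arrived_eq {s : M.DriverClass} {i : V} (h : Uses s i (M.dest s.1)) :
    arrived X s = X s i (M.dest s.1) := by
  classical
  funext t
  unfold arrived
  rw [Finset.sum_eq_single i, if_pos h]
  · intro l _ hl
    rw [if_neg fun h' => hl (h'.source_unique h)]
  · simp

open Classical in
theorem totalEntered_eq (i j : V) (t : ℝ) :
    totalEntered U X i j t = transitEntered U X i j t + departCount U i j t := by
  unfold totalEntered transitEntered departCount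
  rw [← Finset.sum_filter_add_sum_filter_not _ (fun s : M.DriverClass => M.origin s.1 ≠ i)]
  congr 1
  simp only [not_not]
  have hsub : Finset.univ.filter (fun s : M.DriverClass => Starts s i j) ⊆
      Finset.univ.filter (fun s : M.DriverClass => M.origin s.1 = i) := fun s hs => by
    simp only [Finset.mem_filter, Finset.mem_univ, true_and] at hs ⊢
    exact hs.1
  rw [← Finset.sum_subset hsub]
  · refine Finset.sum_congr rfl fun s hs => ?_
    rw [entered_of_starts (Finset.mem_filter.1 hs).2]
  · intro s hs hs'
    simp only [Finset.mem_filter, Finset.mem_univ, true_and] at hs hs'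
    rw [entered_of_not_uses fun h => hs' ⟨hs, h⟩, Pi.zero_apply]

end TrafficModel

/-! ### Departure distributions -/

namespace IsDepartureDistribution

variable {f : ℝ → ℝ} (hf : IsDepartureDistribution f)
include hf

theorem nonneg (t : ℝ) : 0 ≤ f t := hf.mono.le_of_tendsto hf.tendsto_atBot t

theorem le_iSup (t : ℝ) : f t ≤ ⨆ x, f x := le_ciSup hf.bddAbove t

end IsDepartureDistribution

theorem IsTravelKernel.weaken {h : ℝ → ℝ} {a a' Λ Λ' : ℝ} (hh : IsTravelKernel h a Λ)
    (ha' : 0 < a') (ha : a' ≤ a) (hΛ : Λ ≤ Λ') : IsTravelKernel h a' Λ' :=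
  ⟨ha', hh.rate_nonneg.trans hΛ, hh.nonneg, hh.mono, fun x y hxy => (hh.lip x y hxy).trans
    (by gcongr), fun x hx => hh.zero x (hx.trans ha), hh.tendsto⟩

/-- Removing a continuous part from both the count and the level preserves entry times. With the
drivers in transit removed, this leaves an entry time for the departing drivers. -/
theorem IsEntryTime.sub {f e : ℝ → ℝ} (hf : Monotone f) (hec : Continuous e)
    (hfe : Monotone fun x => f x - e x) {c τ : ℝ} (hτ : IsEntryTime f c τ) :
    IsEntryTime (fun x => f x - e x) (c - e τ) τ := by
  rw [isEntryTime_iff hf] at hτ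
  refine (isEntryTime_iff hfe).2 ⟨fun x hx => ?_, fun x hx => ?_⟩
  · refine ge_of_tendsto ((hec.continuousWithinAt (s := Iio τ) (x := τ)).const_sub c) ?_
    filter_upwards [Ioo_mem_nhdsLT hx] with y hy
    have h1 := hfe hy.1.le
    have h2 := hτ.1 y hy.2
    simp only at h1 ⊢
    linarith
  · refine le_of_tendsto ((hec.continuousWithinAt (s := Ioi τ) (x := τ)).const_sub c) ?_
    filter_upwards [Ioo_mem_nhdsGT hx] with y hy
    have h1 := hfe hy.2.le
    have h2 := hτ.2 y hy.1
    simp only at h1 ⊢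
    linarith

theorem frequently_nhdsLT_of_ae {P : ℝ → Prop} (h : ∀ᵐ t : ℝ, P t) (x : ℝ) :
    ∃ᶠ t in 𝓝[<] x, P t := by
  intro hcon
  obtain ⟨l, hl, hsub⟩ := (mem_nhdsLT_iff_exists_Ioo_subset).1 hcon
  have h1 : volume (Ioo l x) ≤ volume {t | ¬ P t} := measure_mono hsub
  rw [ae_iff] at h
  rw [h, Real.volume_Ioo, nonpos_iff_eq_zero, ENNReal.ofReal_eq_zero] at h1
  have : l < x := hl
  linarith

/-! ### Constants uniform over the network -/

namespace TrafficModel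

variable {V : Type*} {n : ℕ} {M : TrafficModel V n} [Fintype V]

/-- All viable arcs have a common minimal travel time and a common bound on the flux. -/
theorem exists_uniform_kernel (hM : M.FluxAssumption) :
    ∃ a Λ, ∀ i j, M.Viable i j → IsTravelKernel (M.kernel i j) a Λ := by
  have h1 : ∀ p : V × V, ∀ᶠ a in 𝓝[>] (0 : ℝ), M.Viable p.1 p.2 →
      a ≤ M.length p.1 p.2 / M.speed p.1 p.2 0 := fun p => by
    by_cases hv : M.Viable p.1 p.2
    · filter_upwards [Ioo_mem_nhdsGT (isTravelKernel_kernel hM hv).delay_pos] with a ha _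
        using ha.2.le
    · exact Eventually.of_forall fun _ h => absurd h hv
  have h2 : ∀ p : V × V, ∀ᶠ Λ in atTop, M.maxFlux p.1 p.2 ≤ Λ := fun p => eventually_ge_atTop _
  obtain ⟨a, ha, ha0⟩ := ((eventually_all.2 h1).and self_mem_nhdsWithin).exists
  obtain ⟨Λ, hΛ⟩ := (eventually_all.2 h2).exists
  exact ⟨a, Λ, fun i j hv => (isTravelKernel_kernel hM hv).weaken ha0 (ha (i, j) hv) (hΛ (i, j))⟩

theorem exists_clearing_time (hM : M.FluxAssumption) (W : ℝ) :
    ∃ C, 0 ≤ C ∧ ∀ i j, M.Viable i j → W ≤ M.kernel i j C := by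
  have h1 : ∀ p : V × V, ∀ᶠ C in atTop, M.Viable p.1 p.2 → W ≤ M.kernel p.1 p.2 C := fun p => by
    by_cases hv : M.Viable p.1 p.2
    · filter_upwards [(isTravelKernel_kernel hM hv).tendsto.eventually_ge_atTop W] with C hC _
        using hC
    · exact Eventually.of_forall fun _ h => absurd h hv
  obtain ⟨C, hC, hC0⟩ := ((eventually_all.2 h1).and (eventually_ge_atTop 0)).exists
  exact ⟨C, hC0, fun i j hv => hC (i, j) hv⟩

/-- Departures, priorities and a corresponding traffic flow. -/
structure IsFeasible (G : Fin n → ℝ) (U B : M.DriverClass → ℝ → ℝ)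
    (X : M.DriverClass → V → V → ℝ → ℝ) : Prop where
  admissible : IsAdmissible G U
  prioritizing : IsPrioritizing U B
  flow : IsFlow U B X

/-! ### Regularity of departures and prioritizing functions -/

section Departures

variable {G : Fin n → ℝ} {U B : M.DriverClass → ℝ → ℝ}

omit [Fintype V] in
theorem size_nonneg (hU : ∀ s, IsDepartureDistribution (U s)) (s : M.DriverClass) :
    0 ≤ size U s := ((hU s).nonneg 0).trans ((hU s).le_iSup 0)

omit [Fintype V] in
theorem le_size (hU : ∀ s, IsDepartureDistribution (U s)) (s : M.DriverClass) (t : ℝ) :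
    U s t ≤ size U s := (hU s).le_iSup t

theorem sum_driverClass (g : M.DriverClass → ℝ) :
    ∑ s, g s = ∑ k, ∑ p : M.Path k, g ⟨k, p⟩ := by
  let e : M.DriverClass ≃ (k : Fin n) × M.Path k := Equiv.refl _
  exact (Fintype.sum_equiv e g (fun s => g (e.symm s)) fun _ => rfl).trans
    (Fintype.sum_sigma fun s => g (e.symm s))

theorem IsAdmissible.sum_size (hU : IsAdmissible G U) : ∑ s, size U s = ∑ k, G k := by
  rw [sum_driverClass]
  exact Finset.sum_congr rfl fun k _ => hU.2 k

theorem IsAdmissible.size_le (hU : IsAdmissible G U) (s : M.DriverClass) :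
    size U s ≤ ∑ k, G k := by
  rw [← hU.sum_size]
  exact Finset.single_le_sum (f := fun s => size U s) (fun s _ => size_nonneg hU.1 s)
    (Finset.mem_univ s)

theorem departCount_mono (hU : ∀ s, IsDepartureDistribution (U s)) (i j : V) :
    Monotone (departCount U i j) := fun _ _ h => Finset.sum_le_sum fun s _ => (hU s).mono h

theorem departCount_mem (hU : ∀ s, IsDepartureDistribution (U s)) (i j : V) (t : ℝ) :
    departCount U i j t ∈ Icc 0 (departSize U i j) :=
  ⟨Finset.sum_nonneg fun s _ => (hU s).nonneg t, Finset.sum_le_sum fun s _ => le_size hU s t⟩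

/-- All increments are nonnegative and they add up to `y - x`, so none exceeds it. -/
theorem IsPrioritizing.sub_le (hB : IsPrioritizing U B) {s : M.DriverClass} {i j : V}
    (hs : Starts s i j) {x y : ℝ} (hx : x ∈ Icc 0 (departSize U i j))
    (hy : y ∈ Icc 0 (departSize U i j)) (hxy : x ≤ y) : B s y - B s x ≤ y - x := by
  classical
  have h1 : ∑ s with Starts s i j, (B s y - B s x) = y - x := by
    rw [Finset.sum_sub_distrib, hB.sum_eq i j x hx, hB.sum_eq i j y hy]
  rw [← h1]
  refine Finset.single_le_sum (f := fun s => B s y - B s x) (fun s' hs' => ?_) ?_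
  · rw [sub_nonneg]
    exact hB.mono s' i j (Finset.mem_filter.1 hs').2 hx hy hxy
  · simpa using hs

theorem IsPrioritizing.continuousOn (hB : IsPrioritizing U B) {s : M.DriverClass} {i j : V}
    (hs : Starts s i j) : ContinuousOn (B s) (Icc 0 (departSize U i j)) := by
  refine LipschitzOnWith.continuousOn (K := 1) (LipschitzOnWith.of_le_add fun x hx y hy => ?_)
  rcases le_total y x with h | h
  · rw [Real.dist_eq, abs_of_nonneg (by linarith)]
    linarith [hB.sub_le hs hy hx h]
  · linarith [hB.mono s i j hs hx hy h, dist_nonneg (x := x) (y := y)]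

/-- Both sides are left-continuous, so almost everywhere equality extends to every `t`. -/
theorem IsPrioritizing.comp_departCount (hB : IsPrioritizing U B)
    (hU : ∀ s, IsDepartureDistribution (U s)) {s : M.DriverClass} {i j : V} (hs : Starts s i j)
    (t : ℝ) : B s (departCount U i j t) = U s t := by
  have h1 : ContinuousWithinAt (departCount U i j) (Iic t) t := by
    unfold departCount
    exact tendsto_finsetSum _ fun s _ => (hU s).left_cont t
  have h2 : ContinuousWithinAt (fun x => B s (departCount U i j x)) (Iic t) t :=
    ContinuousWithinAt.comp (t := Icc 0 (departSize U i j))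
      (hB.continuousOn hs _ (departCount_mem hU i j t)) h1 fun x _ => departCount_mem hU i j x
  refine tendsto_nhds_unique_of_frequently_eq
    (h2.tendsto.mono_left (nhdsWithin_mono t Iio_subset_Iic_self))
    (((hU s).left_cont t).tendsto.mono_left (nhdsWithin_mono t Iio_subset_Iic_self))
    (frequently_nhdsLT_of_ae (hB.comp_eq s i j hs) t)

end Departures

/-! ### A priori estimates for feasible flows -/

section Flow

variable {G : Fin n → ℝ} {U B : M.DriverClass → ℝ → ℝ} {X : M.DriverClass → V → V → ℝ → ℝ}

theorem IsFlow.nonneg (h : IsFlow U B X) (s : M.DriverClass) (i j : V) (t : ℝ) :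
    0 ≤ X s i j t := (h.mono s i j).le_of_tendsto (h.tendsto_atBot s i j) t

theorem entered_mono (hU : ∀ s, Monotone (U s)) (hX : ∀ s i j, Monotone (X s i j))
    (s : M.DriverClass) (i j : V) : Monotone (entered U X s i j) :=
  entered_cases s i j (fun l _ _ _ => hX s l i) (fun _ => hU s) monotone_const

theorem entered_tendsto (hU : ∀ s, Tendsto (U s) atBot (𝓝 0))
    (hX : ∀ s i j, Tendsto (X s i j) atBot (𝓝 0)) (s : M.DriverClass) (i j : V) :
    Tendsto (entered U X s i j) atBot (𝓝 0) :=
  entered_cases (P := fun f => Tendsto f atBot (𝓝 0)) s i j (fun l _ _ _ => hX s l i)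
    (fun _ => hU s) tendsto_const_nhds

theorem totalEntered_mono (hU : ∀ s, Monotone (U s)) (hX : ∀ s i j, Monotone (X s i j))
    (i j : V) : Monotone (totalEntered U X i j) := fun _ _ h =>
  Finset.sum_le_sum fun s _ => entered_mono hU hX s i j h

theorem transitEntered_mono (hU : ∀ s, Monotone (U s)) (hX : ∀ s i j, Monotone (X s i j))
    (i j : V) : Monotone (transitEntered U X i j) := fun _ _ h =>
  Finset.sum_le_sum fun s _ => entered_mono hU hX s i j h

theorem totalEntered_tendsto (hU : ∀ s, Tendsto (U s) atBot (𝓝 0))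
    (hX : ∀ s i j, Tendsto (X s i j) atBot (𝓝 0)) (i j : V) :
    Tendsto (totalEntered U X i j) atBot (𝓝 0) := by
  have := tendsto_finsetSum (Finset.univ : Finset M.DriverClass)
    fun s _ => entered_tendsto hU hX s i j
  rwa [Finset.sum_const_zero] at this

theorem totalEntered_sub_entered_mono (hU : ∀ s, Monotone (U s))
    (hX : ∀ s i j, Monotone (X s i j)) (s : M.DriverClass) (i j : V) :
    Monotone fun t => totalEntered U X i j t - entered U X s i j t := by
  classical
  intro x y h
  simp only [totalEntered]
  rw [← Finset.sum_erase_eq_sub (Finset.mem_univ s), ← Finset.sum_erase_eq_sub (Finset.mem_univ s)]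
  exact Finset.sum_le_sum fun s _ => entered_mono hU hX s i j h

theorem totalEntered_sub_transitEntered (i j : V) :
    (fun t => totalEntered U X i j t - transitEntered U X i j t) = departCount U i j := by
  funext t
  rw [totalEntered_eq, add_sub_cancel_left]

namespace IsFeasible

variable (h : IsFeasible G U B X)
include h

theorem mono_U (s : M.DriverClass) : Monotone (U s) := (h.admissible.1 s).mono

theorem totalEntered_mono (i j : V) : Monotone (totalEntered U X i j) :=
  TrafficModel.totalEntered_mono h.mono_U h.flow.mono i j

theorem totalEntered_tendsto (i j : V) : Tendsto (totalEntered U X i j) atBot (𝓝 0) :=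
  TrafficModel.totalEntered_tendsto (fun s => (h.admissible.1 s).tendsto_atBot)
    h.flow.tendsto_atBot i j

theorem totalEntered_nonneg (i j : V) (t : ℝ) : 0 ≤ totalEntered U X i j t :=
  (h.totalEntered_mono i j).le_of_tendsto (h.totalEntered_tendsto i j) t

theorem totalExited_eq {i j : V} (hv : M.Viable i j) :
    totalExited X i j = infConv (totalEntered U X i j) (M.kernel i j) :=
  funext fun t => h.flow.lax i j hv t

theorem exists_entry {i j : V} (hM : M.FluxAssumption) (hv : M.Viable i j) (t : ℝ) :
    ∃ τ, IsEntryTime (totalEntered U X i j) (totalExited X i j t) τ := by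
  rw [h.totalExited_eq hv]
  exact exists_isEntryTime (h.totalEntered_mono i j) (h.totalEntered_tendsto i j)
    (isTravelKernel_kernel hM hv) t

/-- The increment of one subgroup is at most that of the total, whose rate the Lax-Hopf formula
bounds by `Λ`. This gives the equicontinuity needed for compactness. -/
theorem exit_sub_le {i j : V} {a Λ : ℝ}
    (hh : ∀ i j, M.Viable i j → IsTravelKernel (M.kernel i j) a Λ) (s : M.DriverClass)
    (hs : Uses s i j) {x y : ℝ} (hxy : x ≤ y) : X s i j y - X s i j x ≤ Λ * (y - x) := by
  have hv := hs.viable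
  have h1 : X s i j y - X s i j x ≤ totalExited X i j y - totalExited X i j x := by
    unfold totalExited
    rw [← Finset.sum_sub_distrib]
    exact Finset.single_le_sum (f := fun s => X s i j y - X s i j x)
      (fun s _ => sub_nonneg.2 (h.flow.mono s i j hxy)) (Finset.mem_univ s)
  rw [h.totalExited_eq hv] at h1
  linarith [infConv_lip (h.totalEntered_nonneg i j) (hh i j hv) hxy]

theorem exit_lipschitz {a Λ : ℝ}
    (hh : ∀ i j, M.Viable i j → IsTravelKernel (M.kernel i j) a Λ) (s : M.DriverClass) (i j : V) :
    LipschitzWith Λ.toNNReal (X s i j) := by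
  by_cases hs : Uses s i j
  · refine LipschitzWith.of_le_add_mul _ fun x y => ?_
    rw [Real.coe_toNNReal _ (hh i j hs.viable).rate_nonneg]
    rcases le_total y x with hyx | hxy
    · rw [Real.dist_eq, abs_of_nonneg (by linarith)]
      linarith [h.exit_sub_le hh s hs hyx]
    · have := (hh i j hs.viable).rate_nonneg
      have h1 : 0 ≤ Λ * dist x y := by positivity
      linarith [h.flow.mono s i j hxy]
  · rw [show X s i j = fun _ => 0 from funext (h.flow.not_uses s i j hs)]
    exact (LipschitzWith.const 0).weaken bot_le

theorem exit_continuous (hM : M.FluxAssumption) (s : M.DriverClass) (i j : V) :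
    Continuous (X s i j) := by
  obtain ⟨a, Λ, hh⟩ := exists_uniform_kernel hM
  exact (h.exit_lipschitz hh s i j).continuous

theorem entered_continuous (hM : M.FluxAssumption) {s : M.DriverClass} {i : V} (j : V)
    (hs : M.origin s.1 ≠ i) : Continuous (entered U X s i j) :=
  entered_cases s i j (fun l _ _ _ => h.exit_continuous hM s l i) (fun hs' => absurd hs'.1 hs)
    continuous_const

theorem transitEntered_continuous (hM : M.FluxAssumption) (i j : V) :
    Continuous (transitEntered U X i j) :=
  continuous_finsetSum _ fun s hs =>
    h.entered_continuous hM j (by simpa using hs)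

theorem isEntryTime_departCount (hM : M.FluxAssumption) {i j : V} {c τ : ℝ}
    (hτ : IsEntryTime (totalEntered U X i j) c τ) :
    IsEntryTime (departCount U i j) (c - transitEntered U X i j τ) τ := by
  have hm := departCount_mono h.admissible.1 i j
  rw [← totalEntered_sub_transitEntered (X := X)] at hm ⊢
  exact hτ.sub (h.totalEntered_mono i j) (h.transitEntered_continuous hM i j) hm

/-- The argument at which the flow evaluates a prioritizing function lies in the domain where that
function is constrained. -/
theorem sub_transitEntered_mem (hM : M.FluxAssumption) {i j : V} {c τ : ℝ}
    (hτ : IsEntryTime (totalEntered U X i j) c τ) :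
    c - transitEntered U X i j τ ∈ Icc 0 (departSize U i j) := by
  have h1 := (isEntryTime_iff (departCount_mono h.admissible.1 i j)).1
    (h.isEntryTime_departCount hM hτ)
  exact ⟨(departCount_mem h.admissible.1 i j _).1.trans (h1.1 (τ - 1) (by linarith)),
    (h1.2 (τ + 1) (by linarith)).trans (departCount_mem h.admissible.1 i j _).2⟩

/-- The total satisfies the inequality, so the entry time can be taken at most `t`; monotonicity
then gives it for each subgroup. -/
theorem exit_le_entered (hM : M.FluxAssumption) {s : M.DriverClass} {i j : V} (hs : Uses s i j)
    (t : ℝ) : X s i j t ≤ entered U X s i j t := by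
  have hv := hs.viable
  obtain ⟨τ, hτ⟩ := h.exists_entry hM hv t
  have hle : totalExited X i j t ≤ totalEntered U X i j t := by
    rw [h.totalExited_eq hv]
    exact infConv_le_self (h.totalEntered_nonneg i j) (isTravelKernel_kernel hM hv) t
  obtain ⟨τ, hτt, hτ⟩ := hτ.exists_le (h.totalEntered_mono i j) hle
  rcases hs.starts_or with hs' | ⟨hs', -⟩
  · rw [h.flow.start s i j hs' t τ hτ, entered_of_starts hs',
      ← h.prioritizing.comp_departCount h.admissible.1 hs' t]
    refine h.prioritizing.mono s i j hs' (h.sub_transitEntered_mem hM hτ)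
      (departCount_mem h.admissible.1 i j t) ?_
    -- An entry time controls the departures only at strictly later times. At `τ = t` itself, the
    -- bound comes from the totals.
    rcases hτt.lt_or_eq with hlt | rfl
    · exact ((isEntryTime_iff (departCount_mono h.admissible.1 i j)).1
        (h.isEntryTime_departCount hM hτ)).2 t hlt
    · rw [totalEntered_eq] at hle
      linarith
  · rw [h.flow.transit s i j hs hs' t τ hτ]
    exact entered_mono h.mono_U h.flow.mono s i j hτt

theorem exit_le_depart (hM : M.FluxAssumption) {s : M.DriverClass} {i j : V} (hs : Uses s i j)
    (t : ℝ) : X s i j t ≤ U s t := by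
  refine hs.induction (P := fun i j => X s i j t ≤ U s t) (fun i j h1 => ?_)
    (fun l i j h1 h2 ih => ?_)
  · have := h.exit_le_entered hM h1.uses t
    rwa [entered_of_starts h1] at this
  · have := h.exit_le_entered hM h2 t
    rw [entered_of_uses h1 h2] at this
    exact this.trans ih

theorem exit_le_size (hM : M.FluxAssumption) (s : M.DriverClass) (i j : V) (t : ℝ) :
    X s i j t ≤ size U s := by
  by_cases hs : Uses s i j
  · exact (h.exit_le_depart hM hs t).trans (le_size h.admissible.1 s t)
  · rw [h.flow.not_uses s i j hs]
    exact size_nonneg h.admissible.1 s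

theorem entered_le_size (hM : M.FluxAssumption) (s : M.DriverClass) (i j : V) (t : ℝ) :
    entered U X s i j t ≤ size U s :=
  entered_cases (P := fun f => f t ≤ size U s) s i j (fun l _ _ _ => h.exit_le_size hM s l i t)
    (fun _ => le_size h.admissible.1 s t) (size_nonneg h.admissible.1 s)

theorem totalEntered_le (hM : M.FluxAssumption) (i j : V) (t : ℝ) :
    totalEntered U X i j t ≤ ∑ k, G k := by
  rw [← h.admissible.sum_size]
  exact Finset.sum_le_sum fun s _ => h.entered_le_size hM s i j t

/-- Same argument as `exit_le_entered`, with the entry time chosen at least `t`, because by time `t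
+ C` the arc has cleared everything that entered up to time `t`. -/
theorem entered_le_exit (hM : M.FluxAssumption) {C : ℝ}
    (hC : ∀ i j, M.Viable i j → ∑ k, G k ≤ M.kernel i j C) {s : M.DriverClass} {i j : V}
    (hs : Uses s i j) (t : ℝ) : entered U X s i j t ≤ X s i j (t + C) := by
  have hv := hs.viable
  obtain ⟨τ, hτ⟩ := h.exists_entry hM hv (t + C)
  have hle : totalEntered U X i j t ≤ totalExited X i j (t + C) := by
    rw [h.totalExited_eq hv]
    exact le_infConv_add (h.totalEntered_mono i j) (h.totalEntered_nonneg i j)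
      (h.totalEntered_le hM i j) (isTravelKernel_kernel hM hv) (hC i j hv) t
  obtain ⟨τ, hτt, hτ⟩ := hτ.exists_ge (h.totalEntered_mono i j) hle
  rcases hs.starts_or with hs' | ⟨hs', -⟩
  · rw [h.flow.start s i j hs' _ τ hτ, entered_of_starts hs',
      ← h.prioritizing.comp_departCount h.admissible.1 hs' t]
    refine h.prioritizing.mono s i j hs' (departCount_mem h.admissible.1 i j t)
      (h.sub_transitEntered_mem hM hτ) ?_
    rcases (show t ≤ τ from hτt).lt_or_eq with hlt | rfl
    · exact ((isEntryTime_iff (departCount_mono h.admissible.1 i j)).1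
        (h.isEntryTime_departCount hM hτ)).1 t hlt
    · rw [totalEntered_eq] at hle
      linarith
  · rw [h.flow.transit s i j hs hs' _ τ hτ]
    exact entered_mono h.mono_U h.flow.mono s i j hτt

theorem arrived_mono (s : M.DriverClass) : Monotone (arrived X s) := by
  obtain ⟨i, hi⟩ := exists_uses_dest s
  rw [arrived_eq hi]
  exact h.flow.mono s i _

theorem arrived_le_depart (hM : M.FluxAssumption) (s : M.DriverClass) (t : ℝ) :
    arrived X s t ≤ U s t := by
  obtain ⟨i, hi⟩ := exists_uses_dest s
  rw [arrived_eq hi]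
  exact h.exit_le_depart hM hi t

/-- Add one clearing time for each arc of the path. -/
theorem exists_depart_le_arrived (hM : M.FluxAssumption) (s : M.DriverClass) (t : ℝ) :
    ∃ T, U s t ≤ arrived X s T := by
  obtain ⟨i, hi⟩ := exists_uses_dest s
  rw [arrived_eq hi]
  obtain ⟨C, -, hC⟩ := exists_clearing_time hM (∑ k, G k)
  refine hi.induction (P := fun i j => ∃ T, U s t ≤ X s i j T) (fun i j h1 => ?_)
    (fun l i j h1 h2 ⟨T, hT⟩ => ?_)
  · refine ⟨t + C, ?_⟩
    have := h.entered_le_exit hM hC h1.uses t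
    rwa [entered_of_starts h1] at this
  · refine ⟨T + C, hT.trans ?_⟩
    have := h.entered_le_exit hM hC h2 T
    rwa [entered_of_uses h1 h2] at this

end IsFeasible

end Flow

end TrafficModel

/-! ### Extraction of convergent subsequences -/

/-- Tychonoff in a countable, hence metrizable, product replaces the diagonal argument. -/
theorem exists_subseq_tendsto {ι : Type*} [Countable ι] {z : ℕ → ι → ℝ} {W : ℝ}
    (hz : ∀ N i, z N i ∈ Icc 0 W) :
    ∃ φ : ℕ → ℕ, StrictMono φ ∧ ∀ i, ∃ l, Tendsto (fun N => z (φ N) i) atTop (𝓝 l) := by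
  obtain ⟨l, -, φ, hφ, hl⟩ := (isCompact_univ_pi fun _ : ι => isCompact_Icc (a := (0 : ℝ))
    (b := W)).tendsto_subseq (x := z) fun N i _ => hz N i
  exact ⟨φ, hφ, fun i => ⟨l i, (tendsto_pi_nhds.1 hl) i⟩⟩

theorem exists_tendsto_of_lipschitz {u : ℕ → ℝ → ℝ} {K : NNReal}
    (hu : ∀ N, LipschitzWith K (u N))
    (hq : ∀ q : ℚ, ∃ l, Tendsto (fun N => u N q) atTop (𝓝 l)) :
    ∃ v, LipschitzWith K v ∧ ∀ t, Tendsto (fun N => u N t) atTop (𝓝 (v t)) := by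
  have hc : ∀ t, ∃ l, Tendsto (fun N => u N t) atTop (𝓝 l) := fun t => by
    refine cauchySeq_tendsto_of_complete (Metric.cauchySeq_iff.2 fun ε hε => ?_)
    set δ : ℝ := ε / (3 * (K + 1)) with hδ
    have hK : (0 : ℝ) ≤ K := K.2
    have hδ0 : 0 < δ := by positivity
    have hKδ : K * δ ≤ ε / 3 := by
      rw [hδ, mul_div_assoc', div_le_iff₀ (by positivity)]; nlinarith
    obtain ⟨q, hq1, hq2⟩ := exists_rat_btwn (show t < t + δ by linarith)
    obtain ⟨l, hl⟩ := hq q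
    obtain ⟨N, hN⟩ := Metric.cauchySeq_iff.1 hl.cauchySeq (ε / 3) (by linarith)
    refine ⟨N, fun m hm k hk => ?_⟩
    have hd : dist t (q : ℝ) ≤ δ := by
      rw [dist_comm, Real.dist_eq, abs_of_pos (by linarith)]; linarith
    have h1 : dist (u m t) (u m q) ≤ ε / 3 :=
      ((hu m).dist_le_mul _ _).trans ((mul_le_mul_of_nonneg_left hd hK).trans hKδ)
    have h2 : dist (u k q) (u k t) ≤ ε / 3 := by
      rw [dist_comm]
      exact ((hu k).dist_le_mul _ _).trans ((mul_le_mul_of_nonneg_left hd hK).trans hKδ)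
    have h3 := hN m hm k hk
    linarith [dist_triangle4 (u m t) (u m q) (u k q) (u k t)]
  choose v hv using hc
  refine ⟨v, LipschitzWith.of_dist_le_mul fun x y => ?_, hv⟩
  exact le_of_tendsto' ((hv x).dist (hv y)) fun N => (hu N).dist_le_mul x y

/-- A form of Helly's selection theorem: the weak limit is left-continuous. -/
theorem exists_weakLim {u : ℕ → ℝ → ℝ} {W : ℝ} (hu : ∀ N, Monotone (u N))
    (hW : ∀ N t, u N t ∈ Icc 0 W)
    (hq : ∀ q : ℚ, ∃ l, Tendsto (fun N => u N q) atTop (𝓝 l)) :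
    ∃ v, Monotone v ∧ (∀ t, ContinuousWithinAt v (Iic t) t) ∧ WeakLim u v := by
  choose l hl using hq
  have hlm : Monotone l := fun p q hpq =>
    le_of_tendsto_of_tendsto' (hl p) (hl q) fun N => hu N (by exact_mod_cast hpq)
  have hlW : ∀ q, l q ≤ W := fun q => le_of_tendsto' (hl q) fun N => (hW N q).2
  have hb : ∀ t : ℝ, BddAbove (range fun q : {q : ℚ // (q : ℝ) < t} => l q) := fun t =>
    ⟨W, by rintro _ ⟨q, rfl⟩; exact hlW q⟩
  have hne : ∀ t : ℝ, Nonempty {q : ℚ // (q : ℝ) < t} := fun t =>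
    let ⟨q, hq⟩ := exists_rat_lt t
    ⟨⟨q, hq⟩⟩
  -- The strict inequality `q < t` makes the supremum left-continuous.
  set v : ℝ → ℝ := fun t => ⨆ q : {q : ℚ // (q : ℝ) < t}, l q with hv
  have h1 : ∀ (q : ℚ) t, (q : ℝ) < t → l q ≤ v t := fun q t hqt => le_ciSup (hb t) ⟨q, hqt⟩
  have h2 : ∀ (q : ℚ) t, t ≤ (q : ℝ) → v t ≤ l q := fun q t hqt => ciSup_le fun p =>
    hlm (by exact_mod_cast (p.2.le.trans hqt))
  have hvm : Monotone v := fun s t hst => ciSup_le fun p => h1 p t (p.2.trans_le hst)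
  refine ⟨v, hvm, fun t => ?_, fun a b hab ε hε => ?_⟩
  · rw [Metric.continuousWithinAt_iff]
    intro ε hε
    obtain ⟨q, hq⟩ := exists_lt_of_lt_ciSup (show v t - ε < v t by linarith)
    refine ⟨t - q, by linarith [q.2], fun x hx hd => ?_⟩
    rw [Real.dist_eq, abs_lt] at hd ⊢
    have h3 := h1 q x (by linarith [hd.1])
    have h4 := hvm (show x ≤ t from hx)
    constructor <;> linarith
  · obtain ⟨q, hq1, hq2⟩ := exists_rat_btwn hab
    filter_upwards [(hl q).eventually_le_const (show l q < l q + ε by linarith),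
      (hl q).eventually_const_le (show l q - ε < l q by linarith)] with N h3 h4
    exact ⟨by linarith [hu N hq1.le, h1 q b hq2], by linarith [hu N hq2.le, h2 q a hq1.le]⟩

/-! ### Feasibility of weak limits -/

namespace TrafficModel

variable {V : Type*} {n : ℕ} {M : TrafficModel V n} [Fintype V]

/-- The endpoint of the first arc on the path of `s`. -/
noncomputable def firstStop (s : M.DriverClass) : V := (exists_starts s).choose

omit [Fintype V] in
theorem starts_firstStop (s : M.DriverClass) : Starts s (M.origin s.1) (firstStop s) :=
  (exists_starts s).choose_spec

/-- Number of drivers that start on the same arc as the subgroup `s`. -/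
noncomputable def startSize (U : M.DriverClass → ℝ → ℝ) (s : M.DriverClass) : ℝ :=
  departSize U (M.origin s.1) (firstStop s)

theorem startSize_eq (U : M.DriverClass → ℝ → ℝ) {s : M.DriverClass} {i j : V}
    (h : Starts s i j) : startSize U s = departSize U i j := by
  obtain ⟨rfl, rfl⟩ := h.unique (starts_firstStop s)
  rfl

/-- The priority function of `s`, extended to be constant on both sides of its domain. -/
noncomputable def extendPriority (U B : M.DriverClass → ℝ → ℝ) (s : M.DriverClass) (β : ℝ) : ℝ :=
  B s (max 0 (min (startSize U s) β))

section Extend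

variable {U B : M.DriverClass → ℝ → ℝ}

theorem startSize_nonneg (hU : ∀ s, IsDepartureDistribution (U s)) (s : M.DriverClass) :
    0 ≤ startSize U s := Finset.sum_nonneg fun s _ => size_nonneg hU s

theorem clamp_mem (hU : ∀ s, IsDepartureDistribution (U s)) (s : M.DriverClass) (β : ℝ) :
    max 0 (min (startSize U s) β) ∈ Icc 0 (departSize U (M.origin s.1) (firstStop s)) :=
  ⟨le_max_left _ _, max_le (startSize_nonneg hU s) (min_le_left _ _)⟩

theorem extendPriority_eq {s : M.DriverClass} {β : ℝ} (h : β ∈ Icc 0 (startSize U s)) :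
    extendPriority U B s β = B s β := by
  rw [extendPriority, min_eq_right h.2, max_eq_right h.1]

theorem extendPriority_mem (hU : ∀ s, IsDepartureDistribution (U s)) (hB : IsPrioritizing U B)
    (s : M.DriverClass) (β : ℝ) : extendPriority U B s β ∈ Icc 0 (size U s) :=
  hB.mapsTo s _ _ (starts_firstStop s) (clamp_mem hU s β)

theorem extendPriority_mono (hU : ∀ s, IsDepartureDistribution (U s)) (hB : IsPrioritizing U B)
    (s : M.DriverClass) : Monotone (extendPriority U B s) := fun x y h =>
  hB.mono s _ _ (starts_firstStop s) (clamp_mem hU s x) (clamp_mem hU s y)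
    (max_le_max le_rfl (min_le_min le_rfl h))

theorem extendPriority_lipschitz (hU : ∀ s, IsDepartureDistribution (U s))
    (hB : IsPrioritizing U B) (s : M.DriverClass) : LipschitzWith 1 (extendPriority U B s) := by
  refine LipschitzWith.of_le_add fun x y => ?_
  rcases le_total y x with h | h
  · rw [Real.dist_eq, abs_of_nonneg (by linarith)]
    have h1 := hB.sub_le (starts_firstStop s) (clamp_mem hU s y) (clamp_mem hU s x)
      (max_le_max le_rfl (min_le_min le_rfl h))
    have h2 : max 0 (min (startSize U s) x) - max 0 (min (startSize U s) y) ≤ x - y := by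
      have h3 : min (startSize U s) x ≤ min (startSize U s) y + (x - y) := by
        rw [min_def, min_def]; split_ifs <;> linarith
      rw [max_def, max_def]; split_ifs <;> linarith
    unfold extendPriority
    linarith
  · linarith [extendPriority_mono hU hB s h, dist_nonneg (x := x) (y := y)]

end Extend

/-- Convergence of a sequence of departures, priorities and flows, without loss of drivers. -/
structure FlowLimit (U B : ℕ → M.DriverClass → ℝ → ℝ) (X : ℕ → M.DriverClass → V → V → ℝ → ℝ)
    (U₀ B₀ : M.DriverClass → ℝ → ℝ) (X₀ : M.DriverClass → V → V → ℝ → ℝ)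
    (g : M.DriverClass → ℝ) : Prop where
  tight_left : ∀ s, ∀ ε > 0, ∃ T, ∀ N, U N s T ≤ ε
  tight_right : ∀ s, ∀ ε > 0, ∃ T, ∀ N, size (U N) s ≤ U N s T + ε
  mono : ∀ s, Monotone (U₀ s)
  left_cont : ∀ s t, ContinuousWithinAt (U₀ s) (Iic t) t
  depart : ∀ s, WeakLim (fun N => U N s) (U₀ s)
  size_lim : ∀ s, Tendsto (fun N => size (U N) s) atTop (𝓝 (g s))
  priority : ∀ s β, Tendsto (fun N => extendPriority (U N) (B N) s β) atTop (𝓝 (B₀ s β))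
  exit : ∀ s i j t, Tendsto (fun N => X N s i j t) atTop (𝓝 (X₀ s i j t))
  exit_cont : ∀ s i j, Continuous (X₀ s i j)

namespace FlowLimit

variable {G : Fin n → ℝ} {U B : ℕ → M.DriverClass → ℝ → ℝ}
  {X : ℕ → M.DriverClass → V → V → ℝ → ℝ} {U₀ B₀ : M.DriverClass → ℝ → ℝ}
  {X₀ : M.DriverClass → V → V → ℝ → ℝ} {g : M.DriverClass → ℝ}

/-- Tightness on the left yields the limit `0` at `-∞`; tightness on the right shows that the
limiting total mass `g s` is attained as the supremum, so no driver is lost. -/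
theorem departure (h : FlowLimit U B X U₀ B₀ X₀ g) (hF : ∀ N, IsFeasible G (U N) (B N) (X N))
    (s : M.DriverClass) : IsDepartureDistribution (U₀ s) ∧ size U₀ s = g s := by
  have h0 : ∀ x, 0 ≤ U₀ s x := fun x => le_of_forall_pos_le_add fun ε hε => by
    obtain ⟨N, hN⟩ := (h.depart s (x - 1) x (by linarith) ε hε).exists
    exact (((hF N).admissible.1 s).nonneg _).trans hN.1
  have h1 : ∀ x, U₀ s x ≤ g s := fun x => le_of_forall_pos_le_add fun ε hε => by
    have h2 : Tendsto (fun N => size (U N) s + ε) atTop (𝓝 (g s + ε)) :=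
      (h.size_lim s).add_const ε
    refine ge_of_tendsto h2 ?_
    filter_upwards [h.depart s x (x + 1) (by linarith) ε hε] with N hN
    linarith [hN.2, le_size (hF N).admissible.1 s (x + 1)]
  have hb : BddAbove (range (U₀ s)) := ⟨g s, by rintro _ ⟨x, rfl⟩; exact h1 x⟩
  refine ⟨⟨hb, h.mono s, h.left_cont s, ?_⟩, le_antisymm (ciSup_le h1) ?_⟩
  · rw [Metric.tendsto_nhds]
    intro ε hε
    obtain ⟨T, hT⟩ := h.tight_left s (ε / 3) (by linarith)
    filter_upwards [eventually_lt_atBot T] with x hx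
    obtain ⟨N, hN⟩ := (h.depart s x T hx (ε / 3) (by linarith)).exists
    rw [Real.dist_eq, sub_zero, abs_of_nonneg (h0 x)]
    linarith [hN.2, hT N]
  · refine le_of_forall_pos_le_add fun ε hε => ?_
    obtain ⟨T, hT⟩ := h.tight_right s (ε / 2) (by linarith)
    refine le_of_tendsto (h.size_lim s) ?_
    filter_upwards [h.depart s T (T + 1) (by linarith) (ε / 2) (by linarith)] with N hN
    have : U₀ s (T + 1) ≤ size U₀ s := le_ciSup hb (T + 1)
    linarith [hN.1, hT N]

theorem admissible (h : FlowLimit U B X U₀ B₀ X₀ g)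
    (hF : ∀ N, IsFeasible G (U N) (B N) (X N)) : IsAdmissible G U₀ := by
  refine ⟨fun s => (h.departure hF s).1, fun k => ?_⟩
  have h1 : Tendsto (fun N => ∑ p : M.Path k, size (U N) ⟨k, p⟩) atTop
      (𝓝 (∑ p : M.Path k, size U₀ ⟨k, p⟩)) :=
    tendsto_finsetSum _ fun p _ => by
      rw [(h.departure hF ⟨k, p⟩).2]
      exact h.size_lim ⟨k, p⟩
  refine tendsto_nhds_unique h1 (tendsto_const_nhds.congr fun N => ?_)
  exact ((hF N).admissible.2 k).symm

theorem departSize (h : FlowLimit U B X U₀ B₀ X₀ g)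
    (hF : ∀ N, IsFeasible G (U N) (B N) (X N)) (i j : V) :
    Tendsto (fun N => departSize (U N) i j) atTop (𝓝 (TrafficModel.departSize U₀ i j)) :=
  tendsto_finsetSum _ fun s _ => by
    rw [(h.departure hF s).2]
    exact h.size_lim s

/-- The common Lipschitz constant permits the argument to move with `N`. -/
theorem priority_lipschitz (h : FlowLimit U B X U₀ B₀ X₀ g)
    (hF : ∀ N, IsFeasible G (U N) (B N) (X N)) {s : M.DriverClass} {x : ℕ → ℝ} {x₀ : ℝ}
    (hx : Tendsto x atTop (𝓝 x₀)) :
    Tendsto (fun N => extendPriority (U N) (B N) s (x N)) atTop (𝓝 (B₀ s x₀)) := by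
  have h1 : Tendsto (fun N => extendPriority (U N) (B N) s (x N) -
      extendPriority (U N) (B N) s x₀) atTop (𝓝 0) := by
    refine squeeze_zero_norm (a := fun N => dist (x N) x₀) (fun N => ?_)
      (tendsto_iff_dist_tendsto_zero.1 hx)
    rw [← dist_eq_norm]
    simpa using (extendPriority_lipschitz (hF N).admissible.1
      (hF N).prioritizing s).dist_le_mul (x N) x₀
  simpa using h1.add (h.priority s x₀)

theorem departCount_tendsto (h : FlowLimit U B X U₀ B₀ X₀ g) (i j : V) :
    ∀ᵐ t : ℝ, (∀ s, Tendsto (fun N => U N s t) atTop (𝓝 (U₀ s t))) ∧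
      Tendsto (fun N => departCount (U N) i j t) atTop (𝓝 (departCount U₀ i j t)) := by
  have h1 : ∀ᵐ t : ℝ, ∀ s, ContinuousAt (U₀ s) t := ae_all_iff.2 fun s =>
    (h.mono s).countable_not_continuousAt.measure_zero volume
  filter_upwards [h1] with t ht
  have h2 : ∀ s, Tendsto (fun N => U N s t) atTop (𝓝 (U₀ s t)) := fun s =>
    (h.depart s).tendsto_of_continuousAt (ht s)
  exact ⟨h2, tendsto_finsetSum _ fun s _ => h2 s⟩

theorem prioritizing (h : FlowLimit U B X U₀ B₀ X₀ g)
    (hF : ∀ N, IsFeasible G (U N) (B N) (X N)) : IsPrioritizing U₀ B₀ := by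
  refine ⟨fun s i j hs x _ y _ hxy => ?_, fun s i j hs x _ => ⟨?_, ?_⟩, fun i j β hβ => ?_,
    fun s i j hs => ?_⟩
  · exact le_of_tendsto_of_tendsto' (h.priority s x) (h.priority s y) fun N =>
      extendPriority_mono (hF N).admissible.1 (hF N).prioritizing s hxy
  · exact ge_of_tendsto' (h.priority s x) fun N =>
      (extendPriority_mem (hF N).admissible.1 (hF N).prioritizing s x).1
  · rw [(h.departure hF s).2]
    exact le_of_tendsto_of_tendsto' (h.priority s x) (h.size_lim s) fun N =>
      (extendPriority_mem (hF N).admissible.1 (hF N).prioritizing s x).2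
  · classical
    have h1 : Tendsto (fun N => ∑ s with Starts s i j, extendPriority (U N) (B N) s β) atTop
        (𝓝 (∑ s with Starts s i j, B₀ s β)) := tendsto_finsetSum _ fun s _ => h.priority s β
    -- The domains `[0, departSize (U N) i j]` vary with `N`, so `β` may lie outside some of them.
    -- The extended priorities sum to the clamped value, which tends to `β`.
    have h2 : Tendsto (fun N => max 0 (min (TrafficModel.departSize (U N) i j) β)) atTop
        (𝓝 (max 0 (min (TrafficModel.departSize U₀ i j) β))) :=
      tendsto_const_nhds.max ((h.departSize hF i j).min tendsto_const_nhds)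
    rw [min_eq_right hβ.2, max_eq_right hβ.1] at h2
    refine tendsto_nhds_unique h1 (h2.congr fun N => ?_)
    rw [← (hF N).prioritizing.sum_eq i j (max 0 (min (TrafficModel.departSize (U N) i j) β))
      ⟨le_max_left _ _, max_le (Finset.sum_nonneg fun s _ => size_nonneg (hF N).admissible.1 s)
        (min_le_left _ _)⟩]
    refine Finset.sum_congr (by congr) fun s hs => ?_
    rw [extendPriority, startSize_eq _ (Finset.mem_filter.1 hs).2]
  · filter_upwards [h.departCount_tendsto i j] with t ht
    have h1 := h.priority_lipschitz hF (s := s) ht.2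
    refine tendsto_nhds_unique h1 ((ht.1 s).congr fun N => ?_)
    rw [extendPriority_eq, (hF N).prioritizing.comp_departCount (hF N).admissible.1 hs]
    rw [startSize_eq _ hs]
    exact departCount_mem (hF N).admissible.1 i j t

theorem exit_mono (h : FlowLimit U B X U₀ B₀ X₀ g) (hF : ∀ N, IsFeasible G (U N) (B N) (X N))
    (s : M.DriverClass) (i j : V) : Monotone (X₀ s i j) := fun _ _ hxy =>
  le_of_tendsto_of_tendsto' (h.exit s i j _) (h.exit s i j _) fun N => (hF N).flow.mono s i j hxy

theorem exit_nonneg (h : FlowLimit U B X U₀ B₀ X₀ g) (hF : ∀ N, IsFeasible G (U N) (B N) (X N))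
    (s : M.DriverClass) (i j : V) (t : ℝ) : 0 ≤ X₀ s i j t :=
  ge_of_tendsto' (h.exit s i j t) fun N => (hF N).flow.nonneg s i j t

theorem entered_weakLim (h : FlowLimit U B X U₀ B₀ X₀ g)
    (hF : ∀ N, IsFeasible G (U N) (B N) (X N)) (s : M.DriverClass) (i j : V) :
    WeakLim (fun N => entered (U N) (X N) s i j) (entered U₀ X₀ s i j) := by
  by_cases hs : Uses s i j
  · rcases hs.starts_or with hs' | ⟨-, l, hl⟩
    · simp only [entered_of_starts hs']
      exact h.depart s
    · simp only [entered_of_uses hl hs]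
      exact .of_tendsto (fun N => (hF N).flow.mono s l i) (h.exit s l i)
  · simp only [entered_of_not_uses hs]
    exact .of_tendsto (fun N => monotone_const) fun t => tendsto_const_nhds

theorem totalEntered_weakLim (h : FlowLimit U B X U₀ B₀ X₀ g)
    (hF : ∀ N, IsFeasible G (U N) (B N) (X N)) (i j : V) :
    WeakLim (fun N => totalEntered (U N) (X N) i j) (totalEntered U₀ X₀ i j) :=
  WeakLim.sum Finset.univ fun s _ => h.entered_weakLim hF s i j

theorem entered_tendsto (h : FlowLimit U B X U₀ B₀ X₀ g) {s : M.DriverClass} {i : V} (j : V)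
    (hs : M.origin s.1 ≠ i) (t : ℝ) :
    Tendsto (fun N => entered (U N) (X N) s i j t) atTop (𝓝 (entered U₀ X₀ s i j t)) := by
  by_cases hu : Uses s i j
  · rcases hu.starts_or with hs' | ⟨-, l, hl⟩
    · exact absurd hs'.1 hs
    · simp only [entered_of_uses hl hu]
      exact h.exit s l i t
  · simp only [entered_of_not_uses hu]
    exact tendsto_const_nhds

theorem entered_continuous (h : FlowLimit U B X U₀ B₀ X₀ g) {s : M.DriverClass} {i : V} (j : V)
    (hs : M.origin s.1 ≠ i) : Continuous (entered U₀ X₀ s i j) :=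
  entered_cases s i j (fun l _ _ _ => h.exit_cont s l i) (fun hs' => absurd hs'.1 hs)
    continuous_const

theorem totalExited_tendsto (h : FlowLimit U B X U₀ B₀ X₀ g) (i j : V) (t : ℝ) :
    Tendsto (fun N => totalExited (X N) i j t) atTop (𝓝 (totalExited X₀ i j t)) :=
  tendsto_finsetSum _ fun s _ => h.exit s i j t

theorem flow (h : FlowLimit U B X U₀ B₀ X₀ g) (hM : M.FluxAssumption)
    (hF : ∀ N, IsFeasible G (U N) (B N) (X N)) : IsFlow U₀ B₀ X₀ := by
  have hU := fun s => (h.departure hF s).1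
  have hm := totalEntered_mono (fun s => (hU s).mono) (h.exit_mono hF)
  have hnu : ∀ s i j, ¬ Uses s i j → ∀ t, X₀ s i j t = 0 := fun s i j hs t =>
    tendsto_nhds_unique (h.exit s i j t) (tendsto_const_nhds.congr fun N =>
      ((hF N).flow.not_uses s i j hs t).symm)
  have hbot : ∀ s i j, Tendsto (X₀ s i j) atBot (𝓝 0) := fun s i j => by
    by_cases hs : Uses s i j
    -- Exits are bounded by departures. Weak convergence compares distinct times only, hence the
    -- shift from `t` to `t + 1`.
    · refine tendsto_of_tendsto_of_tendsto_of_le_of_le tendsto_const_nhds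
        ((hU s).tendsto_atBot.comp (tendsto_atBot_add_const_right _ 1 tendsto_id))
        (h.exit_nonneg hF s i j) fun t => le_of_forall_pos_le_add fun ε hε => ?_
      refine le_of_tendsto (h.exit s i j t) ?_
      filter_upwards [h.depart s t (t + 1) (by linarith) ε hε] with N hN
      exact ((hF N).exit_le_depart hM hs t).trans hN.1
    · rw [show X₀ s i j = fun _ => 0 from funext (hnu s i j hs)]
      exact tendsto_const_nhds
  refine ⟨h.exit_mono hF, hbot, hnu, fun i j hv t => ?_, fun s i j hs hs' t τ hτ => ?_,
    fun s i j hs t τ hτ => ?_⟩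
  · rw [laxHopf_eq_infConv]
    refine (h.totalEntered_weakLim hF i j).eq_infConv (fun N => (hF N).totalEntered_mono i j)
      (fun N => (hF N).totalEntered_nonneg i j) ?_ (isTravelKernel_kernel hM hv) ?_
    · exact fun t => (hm i j).le_of_tendsto
        (totalEntered_tendsto (fun s => (hU s).tendsto_atBot) hbot i j) t
    · exact (h.totalExited_tendsto i j t).congr fun N => by rw [(hF N).totalExited_eq hv]
  -- The entry times `σ N` are arbitrary, and so is `τ`; the convergence of values holds for every
  -- such choice.
  · choose σ hσ using fun N => (hF N).exists_entry hM hs.viable t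
    have h1 := (h.totalEntered_weakLim hF i j).tendsto_entry
      (fun N => (hF N).totalEntered_mono i j)
      (fun N => entered_mono (hF N).mono_U (hF N).flow.mono s i j)
      (fun N => (hF N).entered_continuous hM j hs')
      (fun N => totalEntered_sub_entered_mono (hF N).mono_U (hF N).flow.mono s i j)
      (hm i j) (h.entered_continuous j hs') (h.entered_tendsto j hs')
      (h.totalExited_tendsto i j t) hσ hτ
    refine tendsto_nhds_unique (h.exit s i j t) (h1.congr fun N => ?_)
    rw [(hF N).flow.transit s i j hs hs' t (σ N) (hσ N)]
  -- Departures may jump in the limit, so convergence at entry times is applied to the drivers in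
  -- transit only. The priorities then see a convergent argument.
  · choose σ hσ using fun N => (hF N).exists_entry hM hs.uses.viable t
    have h1 := (h.totalEntered_weakLim hF i j).tendsto_entry
      (fun N => (hF N).totalEntered_mono i j)
      (fun N => transitEntered_mono (hF N).mono_U (hF N).flow.mono i j)
      (fun N => (hF N).transitEntered_continuous hM i j)
      (fun N => by
        rw [totalEntered_sub_transitEntered]
        exact departCount_mono (hF N).admissible.1 i j)
      (hm i j) (E := transitEntered U₀ X₀ i j)
      (continuous_finsetSum _ fun s hs => h.entered_continuous j (by simpa using hs))
      (fun t => tendsto_finsetSum _ fun s hs => h.entered_tendsto j (by simpa using hs) t)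
      (h.totalExited_tendsto i j t) hσ hτ
    have h2 := h.priority_lipschitz hF (s := s) ((h.totalExited_tendsto i j t).sub h1)
    refine tendsto_nhds_unique (h.exit s i j t) (h2.congr fun N => ?_)
    rw [(hF N).flow.start s i j hs t (σ N) (hσ N), extendPriority_eq]
    rw [startSize_eq _ hs]
    exact (hF N).sub_transitEntered_mem hM (hσ N)

theorem feasible (h : FlowLimit U B X U₀ B₀ X₀ g) (hM : M.FluxAssumption)
    (hF : ∀ N, IsFeasible G (U N) (B N) (X N)) : IsFeasible G U₀ B₀ X₀ :=
  ⟨h.admissible hF, h.prioritizing hF, h.flow hM hF⟩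

end FlowLimit

/-- Compactness: a sequence of traffic flows whose departures are tight has a convergent
subsequence. -/
theorem exists_flowLimit (hM : M.FluxAssumption) {G : Fin n → ℝ}
    {U B : ℕ → M.DriverClass → ℝ → ℝ} {X : ℕ → M.DriverClass → V → V → ℝ → ℝ}
    (hF : ∀ N, IsFeasible G (U N) (B N) (X N))
    (hl : ∀ s, ∀ ε > 0, ∃ T, ∀ N, U N s T ≤ ε)
    (hr : ∀ s, ∀ ε > 0, ∃ T, ∀ N, size (U N) s ≤ U N s T + ε) :
    ∃ (φ : ℕ → ℕ) (U₀ B₀ : M.DriverClass → ℝ → ℝ) (X₀ : M.DriverClass → V → V → ℝ → ℝ)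
      (g : M.DriverClass → ℝ), StrictMono φ ∧
      FlowLimit (fun N => U (φ N)) (fun N => B (φ N)) (fun N => X (φ N)) U₀ B₀ X₀ g := by
  -- All quantities at rational arguments are collected in one countable family, so that a single
  -- subsequence serves them all.
  set z : ℕ → ((M.DriverClass × ℚ ⊕ M.DriverClass × ℚ) ⊕
      (M.DriverClass × V × V × ℚ ⊕ M.DriverClass)) → ℝ := fun N =>
    Sum.elim (Sum.elim (fun p => U N p.1 p.2) fun p => extendPriority (U N) (B N) p.1 p.2)
      (Sum.elim (fun p => X N p.1 p.2.1 p.2.2.1 p.2.2.2) fun s => size (U N) s) with hz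
  have hbd : ∀ N i, z N i ∈ Icc 0 (∑ k, G k) := by
    intro N i
    have hA := (hF N).admissible
    rcases i with (⟨s, q⟩ | ⟨s, q⟩) | (⟨s, i, j, q⟩ | s)
    · exact ⟨(hA.1 s).nonneg q, (le_size hA.1 s q).trans (hA.size_le s)⟩
    · have := extendPriority_mem hA.1 (hF N).prioritizing s q
      exact ⟨this.1, this.2.trans (hA.size_le s)⟩
    · exact ⟨(hF N).flow.nonneg s i j q, ((hF N).exit_le_size hM s i j q).trans (hA.size_le s)⟩
    · exact ⟨size_nonneg hA.1 s, hA.size_le s⟩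
  obtain ⟨φ, hφ, hlim⟩ := exists_subseq_tendsto hbd
  obtain ⟨a, Λ, hh⟩ := exists_uniform_kernel hM
  choose U₀ h1 h2 h3 using fun s => exists_weakLim (u := fun N => U (φ N) s)
    (fun N => (hF (φ N)).mono_U s)
    (fun N t => ⟨((hF (φ N)).admissible.1 s).nonneg t, (le_size (hF (φ N)).admissible.1 s t).trans
      ((hF (φ N)).admissible.size_le s)⟩)
    fun q => hlim (.inl (.inl (s, q)))
  choose B₀ _ h4 using fun s => exists_tendsto_of_lipschitz
    (u := fun N => extendPriority (U (φ N)) (B (φ N)) s)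
    (fun N => extendPriority_lipschitz (hF (φ N)).admissible.1 (hF (φ N)).prioritizing s)
    fun q => hlim (.inl (.inr (s, q)))
  choose X₀ h5 h6 using fun s i j => exists_tendsto_of_lipschitz
    (u := fun N => X (φ N) s i j) (fun N => (hF (φ N)).exit_lipschitz hh s i j)
    fun q => hlim (.inr (.inl (s, i, j, q)))
  choose g hg using fun s => hlim (.inr (.inr s))
  refine ⟨φ, U₀, B₀, X₀, g, hφ, fun s ε hε => ?_, fun s ε hε => ?_, h1, h2, h3, hg, h4, h6,
    fun s i j => (h5 s i j).continuous⟩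
  · obtain ⟨T, hT⟩ := hl s ε hε
    exact ⟨T, fun N => hT (φ N)⟩
  · obtain ⟨T, hT⟩ := hr s ε hε
    exact ⟨T, fun N => hT (φ N)⟩

end TrafficModel

/-! ### Driver times -/

section DriverTime

variable {f g : ℝ → ℝ} {β t : ℝ}

theorem driverTime_bddBelow (hf : Monotone f) (h0 : Tendsto f atBot (𝓝 0)) (hβ : 0 < β) :
    BddBelow {t | β ≤ f t} := by
  obtain ⟨T, hT⟩ := (h0.eventually_lt_const hβ).exists
  refine ⟨T, fun t ht => ?_⟩
  by_contra! hcon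
  exact absurd (le_trans ht (hf hcon.le)) (not_le.2 hT)

theorem driverTime_le (hf : Monotone f) (h0 : Tendsto f atBot (𝓝 0)) (hβ : 0 < β)
    (h : β ≤ f t) : driverTime f β ≤ t := csInf_le (driverTime_bddBelow hf h0 hβ) h

theorem le_driverTime (hf : Monotone f) (hne : ∃ x, β ≤ f x) (h : f t < β) :
    t ≤ driverTime f β := by
  refine le_csInf hne fun x hx => ?_
  by_contra! hcon
  exact absurd (le_trans hx (hf hcon.le)) (not_le.2 h)

theorem lt_of_lt_driverTime (hf : Monotone f) (h0 : Tendsto f atBot (𝓝 0)) (hβ : 0 < β)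
    (h : t < driverTime f β) : f t < β :=
  not_le.1 fun hcon => absurd (driverTime_le hf h0 hβ hcon) (not_le.2 h)

theorem driverTime_le_of_le (hf : Monotone f) (h0 : Tendsto f atBot (𝓝 0)) (hβ : 0 < β)
    (hgf : ∀ t, g t ≤ f t) (hne : ∃ x, β ≤ g x) : driverTime f β ≤ driverTime g β :=
  csInf_le_csInf (driverTime_bddBelow hf h0 hβ) hne fun t ht => le_trans ht (hgf t)

theorem driverTime_monotoneOn (hf : Monotone f) (h0 : Tendsto f atBot (𝓝 0)) {b : ℝ}
    (hne : ∀ β < b, ∃ x, β ≤ f x) : MonotoneOn (driverTime f) (Ioo 0 b) := fun _ hx y hy hxy =>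
  csInf_le_csInf (driverTime_bddBelow hf h0 hx.1) (hne y hy.2) fun _ ht => le_trans hxy ht

end DriverTime

/-! ### Extended integrals -/

/-- The lower bound makes the negative part integrable, so the extended difference reduces to adding
a constant. The bound is required only on the open interval because the label `b` itself may never
be reached, in which case `driverTime` is the infimum of the empty set. -/
theorem extIntegral_eq_sub {f : ℝ → ℝ} {b m : ℝ} (hb : 0 ≤ b) (hm : 0 ≤ m)
    (hf : AEMeasurable f (volume.restrict (Ioc 0 b))) (hfm : ∀ β ∈ Ioo 0 b, -m ≤ f β) :
    extIntegral f b =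
      ((∫⁻ β in Ioc 0 b, ENNReal.ofReal (f β + m) : ENNReal) : EReal) +
        ((-(m * b) : ℝ) : EReal) := by
  have hae : ∀ᵐ β ∂(volume.restrict (Ioc 0 b)), -m ≤ f β := by
    rw [← Measure.restrict_congr_set (Ioo_ae_eq_Ioc (μ := volume))]
    exact (ae_restrict_iff' measurableSet_Ioo).2 (Eventually.of_forall hfm)
  have hconst : ∫⁻ _β in Ioc 0 b, ENNReal.ofReal m = ENNReal.ofReal (m * b) := by
    rw [setLIntegral_const, Real.volume_Ioc, sub_zero, ENNReal.ofReal_mul hm]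
  have hsum : (∫⁻ β in Ioc 0 b, ENNReal.ofReal (f β + m)) +
        ∫⁻ β in Ioc 0 b, ENNReal.ofReal (-f β) =
      (∫⁻ β in Ioc 0 b, ENNReal.ofReal (f β)) + ENNReal.ofReal (m * b) := by
    rw [← hconst, ← lintegral_add_right' _ (g := fun β => ENNReal.ofReal (-f β)) hf.neg.ennreal_ofReal,
      ← lintegral_add_right' _ aemeasurable_const]
    refine lintegral_congr_ae ?_
    filter_upwards [hae] with β hβ
    rcases le_total 0 (f β) with h0 | h0
    · rw [ENNReal.ofReal_of_nonpos (show -f β ≤ 0 by linarith), add_zero, ENNReal.ofReal_add h0 hm]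
    · rw [ENNReal.ofReal_of_nonpos h0, zero_add, ← ENNReal.ofReal_add (by linarith) (by linarith)]
      congr 1
      ring
  have hneg : ∫⁻ β in Ioc 0 b, ENNReal.ofReal (-f β) ≤ ENNReal.ofReal (m * b) := by
    rw [← hconst]
    refine lintegral_mono_ae ?_
    filter_upwards [hae] with β hβ
    exact ENNReal.ofReal_le_ofReal (by linarith)
  unfold extIntegral
  generalize (∫⁻ β in Ioc 0 b, ENNReal.ofReal (f β + m)) = I at *
  generalize (∫⁻ β in Ioc 0 b, ENNReal.ofReal (f β)) = P at *
  generalize (∫⁻ β in Ioc 0 b, ENNReal.ofReal (-f β)) = Q at *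
  have hQ : Q ≠ ⊤ := ne_top_of_le_ne_top ENNReal.ofReal_ne_top hneg
  lift Q to NNReal using hQ
  have hcoe : ∀ x : NNReal, ((x : ENNReal) : EReal) = ((x : ℝ) : EReal) := fun _ => rfl
  -- With `Q` finite, `P` and `I` are infinite together; otherwise the identity `hsum` becomes one
  -- between real numbers.
  by_cases hP : P = ⊤
  · subst hP
    have hI : I = ⊤ := by
      by_contra hI
      rw [top_add] at hsum
      exact ENNReal.add_ne_top.2 ⟨hI, ENNReal.coe_ne_top⟩ hsum
    subst hI
    rw [EReal.coe_ennreal_top, EReal.top_add_coe, hcoe,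
      EReal.top_sub_coe]
  · have hI : I ≠ ⊤ := by
      intro hI
      rw [hI, top_add] at hsum
      exact ENNReal.add_ne_top.2 ⟨hP, ENNReal.ofReal_ne_top⟩ hsum.symm
    lift P to NNReal using hP
    lift I to NNReal using hI
    have h1 := congrArg ENNReal.toReal hsum
    rw [ENNReal.toReal_add ENNReal.coe_ne_top ENNReal.coe_ne_top,
      ENNReal.toReal_add ENNReal.coe_ne_top ENNReal.ofReal_ne_top,
      ENNReal.toReal_ofReal (mul_nonneg hm hb)] at h1
    simp only [ENNReal.coe_toReal] at h1
    rw [hcoe, hcoe,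
      hcoe, ← EReal.coe_sub, ← EReal.coe_add, EReal.coe_eq_coe_iff]
    linarith

namespace TrafficModel

variable {V : Type*} {n : ℕ} {M : TrafficModel V n}

/-! ### Costs -/

theorem CostAssumption.depart_anti (hc : M.CostAssumption) (k : Fin n) :
    Antitone (M.departCost k) := (strictAnti_of_deriv_neg (hc.depart_deriv_neg k)).antitone

theorem CostAssumption.arrive_mono (hc : M.CostAssumption) (k : Fin n) :
    Monotone (M.arriveCost k) := (strictMono_of_deriv_pos (hc.arrive_deriv_pos k)).monotone

theorem CostAssumption.exists_lower_bound (hc : M.CostAssumption) :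
    ∃ m, 0 ≤ m ∧ ∀ k t, -m ≤ M.departCost k t + M.arriveCost k t := by
  have h1 : ∀ k, ∀ᶠ m in atTop, ∀ t, -m ≤ M.departCost k t + M.arriveCost k t := fun k => by
    have hcont : Continuous fun t => M.departCost k t + M.arriveCost k t :=
      (hc.depart_contDiff k).continuous.add (hc.arrive_contDiff k).continuous
    obtain ⟨t₀, ht₀⟩ := hcont.exists_forall_le (by
      rw [cocompact_eq_atBot_atTop]
      exact (hc.tendsto_atBot k).sup (hc.tendsto_atTop k))
    filter_upwards [eventually_ge_atTop (-(M.departCost k t₀ + M.arriveCost k t₀))] with m hm t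
    have := ht₀ t
    linarith
  obtain ⟨m, h2, h3⟩ := ((eventually_all.2 h1).and (eventually_ge_atTop 0)).exists
  exact ⟨m, h3, h2⟩

variable [Fintype V]

/-- The cost of the `β`-th driver of the subgroup `s`. -/
noncomputable def driverCost (U : M.DriverClass → ℝ → ℝ) (X : M.DriverClass → V → V → ℝ → ℝ)
    (s : M.DriverClass) (β : ℝ) : ℝ :=
  M.departCost s.1 (driverTime (U s) β) + M.arriveCost s.1 (driverTime (arrived X s) β)

/-- The cost of the subgroup `s`, if every driver pays the additional amount `m`. -/
noncomputable def shiftedCost (m : ℝ) (U : M.DriverClass → ℝ → ℝ)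
    (X : M.DriverClass → V → V → ℝ → ℝ) (s : M.DriverClass) : ENNReal :=
  ∫⁻ β in Ioc 0 (size U s), ENNReal.ofReal (driverCost U X s β + m)

omit [Fintype V] in
theorem exists_le_of_lt_size {U : M.DriverClass → ℝ → ℝ} (s : M.DriverClass) (β : ℝ)
    (hβ : β < size U s) : ∃ t, β ≤ U s t :=
  let ⟨t, ht⟩ := exists_lt_of_lt_ciSup hβ
  ⟨t, ht.le⟩

namespace IsFeasible

variable {G : Fin n → ℝ} {U B : M.DriverClass → ℝ → ℝ} {X : M.DriverClass → V → V → ℝ → ℝ}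

theorem exists_arrived (h : IsFeasible G U B X) (hM : M.FluxAssumption) (s : M.DriverClass)
    (β : ℝ) (hβ : β < size U s) : ∃ t, β ≤ arrived X s t := by
  obtain ⟨t, ht⟩ := exists_le_of_lt_size s β hβ
  obtain ⟨T, hT⟩ := h.exists_depart_le_arrived hM s t
  exact ⟨T, ht.trans hT⟩

theorem arrived_tendsto (h : IsFeasible G U B X) (s : M.DriverClass) :
    Tendsto (arrived X s) atBot (𝓝 0) := by
  obtain ⟨i, hi⟩ := exists_uses_dest s
  rw [arrived_eq hi]
  exact h.flow.tendsto_atBot s i _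

theorem depart_tendsto (h : IsFeasible G U B X) (s : M.DriverClass) :
    Tendsto (U s) atBot (𝓝 0) := (h.admissible.1 s).tendsto_atBot

/-- Arrival counts never exceed departure counts, so the `β`-th arrival is not before the `β`-th
departure. -/
theorem le_driverCost (h : IsFeasible G U B X) (hM : M.FluxAssumption) (hc : M.CostAssumption)
    (s : M.DriverClass) {β : ℝ} (hβ : β ∈ Ioo 0 (size U s)) :
    M.departCost s.1 (driverTime (U s) β) + M.arriveCost s.1 (driverTime (U s) β) ≤
      driverCost U X s β := by
  unfold driverCost
  gcongr
  exact hc.arrive_mono s.1 (driverTime_le_of_le (h.mono_U s) (h.depart_tendsto s) hβ.1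
    (h.arrived_le_depart hM s) (h.exists_arrived hM s β hβ.2))

theorem driverCost_aemeasurable (h : IsFeasible G U B X) (hM : M.FluxAssumption)
    (hc : M.CostAssumption) (s : M.DriverClass) :
    AEMeasurable (driverCost U X s) (volume.restrict (Ioo 0 (size U s))) := by
  refine AEMeasurable.add ?_ ?_
  · exact (hc.depart_contDiff s.1).continuous.measurable.comp_aemeasurable
      (aemeasurable_restrict_of_monotoneOn measurableSet_Ioo
        (driverTime_monotoneOn (h.mono_U s) (h.depart_tendsto s) (exists_le_of_lt_size s)))
  · exact (hc.arrive_contDiff s.1).continuous.measurable.comp_aemeasurable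
      (aemeasurable_restrict_of_monotoneOn measurableSet_Ioo
        (driverTime_monotoneOn (h.arrived_mono s) (h.arrived_tendsto s) (h.exists_arrived hM s)))

/-- The correction depends on the group sizes alone, so minimizing the cost amounts to minimizing a
sum of integrals with values in `[0, ∞]`. -/
theorem totalCost_eq (h : IsFeasible G U B X) (hM : M.FluxAssumption) (hc : M.CostAssumption)
    {m : ℝ} (hm : 0 ≤ m) (hm' : ∀ k t, -m ≤ M.departCost k t + M.arriveCost k t) :
    totalCost U X = ((∑ s, shiftedCost m U X s : ENNReal) : EReal) +
      ((-(m * ∑ k, G k) : ℝ) : EReal) := by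
  have h1 : ∀ s, extIntegral (driverCost U X s) (size U s) =
      ((shiftedCost m U X s : ENNReal) : EReal) + ((-(m * size U s) : ℝ) : EReal) := fun s => by
    refine extIntegral_eq_sub (size_nonneg h.admissible.1 s) hm ?_ fun β hβ =>
      (hm' _ _).trans (h.le_driverCost hM hc s hβ)
    rw [← Measure.restrict_congr_set (Ioo_ae_eq_Ioc (μ := volume))]
    exact h.driverCost_aemeasurable hM hc s
  have h2 : totalCost U X = ∑ s, extIntegral (driverCost U X s) (size U s) := rfl
  rw [h2, Finset.sum_congr rfl fun s _ => h1 s, Finset.sum_add_distrib, ← h.admissible.sum_size,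
    Finset.mul_sum, ← Finset.sum_neg_distrib]
  congr 1
  · exact (map_sum
      (⟨⟨(↑), EReal.coe_ennreal_zero⟩, EReal.coe_ennreal_add⟩ : ENNReal →+ EReal) _ _).symm
  · exact (map_sum (⟨⟨Real.toEReal, EReal.coe_zero⟩, EReal.coe_add⟩ : ℝ →+ EReal) _ _).symm

/-- A bound on the cost limits the number of drivers with large individual cost. -/
theorem mul_le_of_shiftedCost_le (h : IsFeasible G U B X) (hM : M.FluxAssumption)
    (hc : M.CostAssumption) {m : ℝ} (hm : 0 ≤ m) {s : M.DriverClass} {C : ENNReal} (hC : C ≠ ⊤)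
    (hle : shiftedCost m U X s ≤ C) {a b K : ℝ} (ha : 0 ≤ a) (hab : a ≤ b) (hb : b ≤ size U s)
    (hK : ∀ β ∈ Ioo a b, K ≤ M.departCost s.1 (driverTime (U s) β) +
      M.arriveCost s.1 (driverTime (U s) β)) : K * (b - a) ≤ C.toReal := by
  rcases lt_or_ge K 0 with hK0 | hK0
  · exact (mul_nonpos_of_nonpos_of_nonneg hK0.le (by linarith)).trans ENNReal.toReal_nonneg
  rw [← ENNReal.ofReal_le_iff_le_toReal hC, ENNReal.ofReal_mul hK0, ← Real.volume_Ioo,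
    ← setLIntegral_const]
  refine le_trans (le_trans (setLIntegral_mono' measurableSet_Ioo fun β hβ => ?_)
    (lintegral_mono_set (show Ioo a b ⊆ Ioc 0 (size U s) from
      fun x hx => ⟨ha.trans_lt hx.1, hx.2.le.trans hb⟩))) hle
  have h1 := h.le_driverCost hM hc s (β := β) ⟨ha.trans_lt hβ.1, hβ.2.trans_le hb⟩
  exact ENNReal.ofReal_le_ofReal (by linarith [hK β hβ])

end IsFeasible

/-! ### Bounded cost implies tightness -/

section Tightness

variable {G : Fin n → ℝ} {U B : ℕ → M.DriverClass → ℝ → ℝ}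
  {X : ℕ → M.DriverClass → V → V → ℝ → ℝ} {m : ℝ} {C : ENNReal}

/-- Departures before a suitably early `T` cost at least `C / ε + 1` each, so more than `ε` of them
would exceed the budget `C`. -/
theorem tight_left (hM : M.FluxAssumption) (hc : M.CostAssumption)
    (hF : ∀ N, IsFeasible G (U N) (B N) (X N)) (hm : 0 ≤ m) (hC : C ≠ ⊤)
    (hle : ∀ N s, shiftedCost m (U N) (X N) s ≤ C) (s : M.DriverClass) (ε : ℝ) (hε : 0 < ε) :
    ∃ T, ∀ N, U N s T ≤ ε := by
  obtain ⟨T, hT⟩ := eventually_atBot.1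
    ((hc.tendsto_atBot s.1).eventually_ge_atTop (C.toReal / ε + 1))
  refine ⟨T, fun N => ?_⟩
  have hU := (hF N).admissible.1 s
  have h1 := (hF N).mul_le_of_shiftedCost_le hM hc hm hC (hle N s) le_rfl (hU.nonneg T)
    (le_size (hF N).admissible.1 s T) (K := C.toReal / ε + 1) fun β hβ =>
      hT _ (driverTime_le hU.mono hU.tendsto_atBot hβ.1 hβ.2.le)
  by_contra! hcon
  have h2 : (C.toReal / ε + 1) * ε ≤ (C.toReal / ε + 1) * (U N s T - 0) := by
    have : 0 ≤ C.toReal := ENNReal.toReal_nonneg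
    gcongr
    linarith
  have h3 : (C.toReal / ε + 1) * ε = C.toReal + ε := by field_simp
  linarith

theorem tight_right (hM : M.FluxAssumption) (hc : M.CostAssumption)
    (hF : ∀ N, IsFeasible G (U N) (B N) (X N)) (hm : 0 ≤ m) (hC : C ≠ ⊤)
    (hle : ∀ N s, shiftedCost m (U N) (X N) s ≤ C) (s : M.DriverClass) (ε : ℝ) (hε : 0 < ε) :
    ∃ T, ∀ N, size (U N) s ≤ U N s T + ε := by
  obtain ⟨T, hT⟩ := eventually_atTop.1
    ((hc.tendsto_atTop s.1).eventually_ge_atTop (C.toReal / ε + 1))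
  refine ⟨T, fun N => ?_⟩
  have hU := (hF N).admissible.1 s
  have h1 := (hF N).mul_le_of_shiftedCost_le hM hc hm hC (hle N s) (hU.nonneg T)
    (le_size (hF N).admissible.1 s T) le_rfl (K := C.toReal / ε + 1) fun β hβ =>
      hT _ (le_driverTime hU.mono (exists_le_of_lt_size s β hβ.2) hβ.1)
  by_contra! hcon
  have h2 : (C.toReal / ε + 1) * ε ≤ (C.toReal / ε + 1) * (size (U N) s - U N s T) := by
    have : 0 ≤ C.toReal := ENNReal.toReal_nonneg
    gcongr
    linarith
  have h3 : (C.toReal / ε + 1) * ε = C.toReal + ε := by field_simp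
  linarith

end Tightness

/-! ### Lower semicontinuity of the cost -/

namespace FlowLimit

variable {G : Fin n → ℝ} {U B : ℕ → M.DriverClass → ℝ → ℝ}
  {X : ℕ → M.DriverClass → V → V → ℝ → ℝ} {U₀ B₀ : M.DriverClass → ℝ → ℝ}
  {X₀ : M.DriverClass → V → V → ℝ → ℝ} {g : M.DriverClass → ℝ}

/-- Excluding the countably many values of `U₀ s` at rationals gives `U₀ s q > β` strictly at a
rational `q` close to the driver time. This margin survives weak convergence; it may be absent if
`U₀ s` is flat at level `β`. -/
theorem eventually_driverTime_depart_le (h : FlowLimit U B X U₀ B₀ X₀ g)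
    (hF : ∀ N, IsFeasible G (U N) (B N) (X N)) {s : M.DriverClass}
    {β ε : ℝ} (hε : 0 < ε) (hβ : β ∈ Ioo 0 (size U₀ s))
    (hβ' : β ∉ range fun q : ℚ => U₀ s q) :
    ∀ᶠ N in atTop, driverTime (U N s) β ≤ driverTime (U₀ s) β + ε := by
  obtain ⟨t, ht, htε⟩ := exists_lt_of_csInf_lt (exists_le_of_lt_size s β hβ.2)
    (show driverTime (U₀ s) β < driverTime (U₀ s) β + ε by linarith)
  obtain ⟨q, hq1, hq2⟩ := exists_rat_btwn htε
  have hlt : β < U₀ s q := lt_of_le_of_ne (le_trans ht (h.mono s hq1.le)) fun he =>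
    hβ' ⟨q, he.symm⟩
  filter_upwards [h.depart s q _ hq2 (U₀ s q - β) (by linarith)] with N hN
  exact driverTime_le ((hF N).mono_U s) ((hF N).depart_tendsto s) hβ.1 (by linarith [hN.2])

theorem eventually_le_driverTime_arrived (h : FlowLimit U B X U₀ B₀ X₀ g)
    (hM : M.FluxAssumption) (hF : ∀ N, IsFeasible G (U N) (B N) (X N)) {s : M.DriverClass}
    {β ε : ℝ} (hε : 0 < ε) (hβ : β ∈ Ioo 0 (size U₀ s)) :
    ∀ᶠ N in atTop, driverTime (arrived X₀ s) β - ε ≤ driverTime (arrived (X N) s) β := by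
  have hF₀ := h.feasible hM hF
  have h1 : arrived X₀ s (driverTime (arrived X₀ s) β - ε) < β :=
    lt_of_lt_driverTime (hF₀.arrived_mono s) (hF₀.arrived_tendsto s) hβ.1 (by linarith)
  have h2 : ∀ t, Tendsto (fun N => arrived (X N) s t) atTop (𝓝 (arrived X₀ s t)) := fun t => by
    obtain ⟨i, hi⟩ := exists_uses_dest s
    simp only [arrived_eq hi]
    exact h.exit s i _ t
  have h3 : β < g s := (h.departure hF s).2 ▸ hβ.2
  filter_upwards [(h2 _).eventually_lt_const h1, (h.size_lim s).eventually_const_lt h3]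
    with N h4 h5
  exact le_driverTime ((hF N).arrived_mono s) ((hF N).exists_arrived hM s β h5) h4

/-- Lower semicontinuity of the cost. -/
theorem shiftedCost_le_liminf (h : FlowLimit U B X U₀ B₀ X₀ g) (hM : M.FluxAssumption)
    (hc : M.CostAssumption) (hF : ∀ N, IsFeasible G (U N) (B N) (X N)) (m : ℝ)
    (s : M.DriverClass) :
    shiftedCost m U₀ X₀ s ≤ liminf (fun N => shiftedCost m (U N) (X N) s) atTop := by
  -- The subgroup sizes vary along the sequence. Cutting off at `size (U N) s` puts all integrands
  -- on one domain for Fatou's lemma.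
  set F : ℕ → ℝ → ENNReal := fun N =>
    (Ioo 0 (size (U N) s)).indicator fun β => ENNReal.ofReal (driverCost (U N) (X N) s β + m)
    with hFdef
  have hmeas : ∀ N, AEMeasurable (F N) volume := fun N => by
    rw [hFdef, aemeasurable_indicator_iff measurableSet_Ioo]
    exact (((hF N).driverCost_aemeasurable hM hc s).add_const m).ennreal_ofReal
  have hint : ∀ N, ∫⁻ β in Ioo 0 (size U₀ s), F N β ≤ shiftedCost m (U N) (X N) s := fun N => by
    refine (setLIntegral_le_lintegral _ _).trans ?_
    rw [hFdef, lintegral_indicator measurableSet_Ioo]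
    exact lintegral_mono_set Ioo_subset_Ioc_self
  have hrange : ∀ᵐ β : ℝ, β ∉ range fun q : ℚ => U₀ s q :=
    (countable_range _).ae_notMem volume
  have hpt : ∀ᵐ β ∂(volume.restrict (Ioo 0 (size U₀ s))),
      ENNReal.ofReal (driverCost U₀ X₀ s β + m) ≤ liminf (fun N => F N β) atTop := by
    filter_upwards [ae_restrict_of_ae hrange, ae_restrict_mem measurableSet_Ioo] with β hβ' hβ
    refine le_of_forall_lt fun y hy => ?_
    have hcont : ContinuousAt (fun ε : ℝ => ENNReal.ofReal
        (M.departCost s.1 (driverTime (U₀ s) β + ε) +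
          M.arriveCost s.1 (driverTime (arrived X₀ s) β - ε) + m)) 0 := by
      have h1 := (hc.depart_contDiff s.1).continuous
      have h2 := (hc.arrive_contDiff s.1).continuous
      exact (ENNReal.continuous_ofReal.comp (by fun_prop)).continuousAt
    have hy0 : y < ENNReal.ofReal (M.departCost s.1 (driverTime (U₀ s) β + 0) +
          M.arriveCost s.1 (driverTime (arrived X₀ s) β - 0) + m) := by
      rw [add_zero, sub_zero]; exact hy
    have h3 := (hcont.eventually (lt_mem_nhds hy0)).filter_mono
      (nhdsWithin_le_nhds (s := Ioi (0 : ℝ)))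
    -- Continuity of the costs leaves room for an error `ε > 0` in both times; departing later or
    -- arriving earlier lowers the cost, so the one-sided time bounds suffice.
    obtain ⟨ε, h4, hε⟩ := (h3.and self_mem_nhdsWithin).exists
    refine h4.trans_le (le_liminf_of_le (by isBoundedDefault) ?_)
    have h5 : β < g s := (h.departure hF s).2 ▸ hβ.2
    filter_upwards [h.eventually_driverTime_depart_le hF hε hβ hβ',
      h.eventually_le_driverTime_arrived hM hF hε hβ, (h.size_lim s).eventually_const_lt h5]
      with N h6 h7 h8
    simp only [hFdef]
    rw [indicator_of_mem (show β ∈ Ioo 0 (size (U N) s) from ⟨hβ.1, h8⟩)]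
    refine ENNReal.ofReal_le_ofReal ?_
    have h9 := hc.depart_anti s.1 h6
    have h10 := hc.arrive_mono s.1 h7
    unfold driverCost
    linarith
  calc shiftedCost m U₀ X₀ s
      = ∫⁻ β in Ioo 0 (size U₀ s), ENNReal.ofReal (driverCost U₀ X₀ s β + m) := by
        rw [shiftedCost, Measure.restrict_congr_set (Ioo_ae_eq_Ioc (μ := volume))]
    _ ≤ ∫⁻ β in Ioo 0 (size U₀ s), liminf (fun N => F N β) atTop := lintegral_mono_ae hpt
    _ ≤ liminf (fun N => ∫⁻ β in Ioo 0 (size U₀ s), F N β) atTop :=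
        lintegral_liminf_le' fun N => (hmeas N).restrict
    _ ≤ _ := liminf_le_liminf (Eventually.of_forall hint)

end FlowLimit

/-- If some feasible choice has finite cost, then the cost attains its minimum. -/
theorem exists_minimizer (hM : M.FluxAssumption) (hc : M.CostAssumption) {G : Fin n → ℝ} {m : ℝ}
    (hm : 0 ≤ m)
    (hex : ∃ U B X, IsFeasible (M := M) G U B X ∧ ∑ s, shiftedCost m U X s ≠ ⊤) :
    ∃ U B X, IsFeasible (M := M) G U B X ∧ ∑ s, shiftedCost m U X s ≠ ⊤ ∧
      ∀ U' B' X', IsFeasible (M := M) G U' B' X' →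
        ∑ s, shiftedCost m U X s ≤ ∑ s, shiftedCost m U' X' s := by
  set S : Set ENNReal := {c | ∃ U B X, IsFeasible (M := M) G U B X ∧ ∑ s, shiftedCost m U X s = c}
    with hS
  have hne : S.Nonempty := by
    obtain ⟨U, B, X, hF, -⟩ := hex
    exact ⟨_, U, B, X, hF, rfl⟩
  have hfin : sInf S < ⊤ := by
    obtain ⟨U, B, X, hF, h⟩ := hex
    exact sInf_lt_iff.2 ⟨_, ⟨U, B, X, hF, rfl⟩, h.lt_top⟩
  obtain ⟨c, hanti, hlim, hcS⟩ := exists_seq_tendsto_sInf hne (OrderBot.bddBelow S)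
  obtain ⟨N₀, hN₀⟩ := eventually_atTop.1 (hlim.eventually_lt_const hfin)
  choose U B X hF hcost using fun N => hcS (N₀ + N)
  have hle : ∀ N s, shiftedCost m (U N) (X N) s ≤ c N₀ := fun N s =>
    (Finset.single_le_sum (f := fun s => shiftedCost m (U N) (X N) s) (fun _ _ => zero_le)
      (Finset.mem_univ s)).trans ((hcost N).le.trans (hanti (Nat.le_add_right _ _)))
  have hlim' : Tendsto (fun N => ∑ s, shiftedCost m (U N) (X N) s) atTop (𝓝 (sInf S)) := by
    simp only [hcost]
    exact hlim.comp (tendsto_atTop_mono (fun N => Nat.le_add_left N N₀) tendsto_id)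
  have hC := (hN₀ N₀ le_rfl).ne
  -- Making the cost of each subgroup converge in the compact space `ENNReal` allows semicontinuity
  -- to be applied termwise, with limits that add up to the infimum.
  obtain ⟨l, φ, hφ, hl⟩ := CompactSpace.tendsto_subseq fun N s => shiftedCost m (U N) (X N) s
  obtain ⟨ψ, U₀, B₀, X₀, g, hψ, hL⟩ := exists_flowLimit hM (fun N => hF (φ N))
    (tight_left hM hc (fun N => hF (φ N)) hm hC fun N => hle (φ N))
    (tight_right hM hc (fun N => hF (φ N)) hm hC fun N => hle (φ N))
  have hl' : ∀ s, Tendsto (fun N => shiftedCost m (U (φ (ψ N))) (X (φ (ψ N))) s) atTop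
      (𝓝 (l s)) := fun s => ((tendsto_pi_nhds.1 hl) s).comp hψ.tendsto_atTop
  have hsum : ∑ s, l s = sInf S := tendsto_nhds_unique
    (tendsto_finsetSum _ fun s _ => hl' s)
    (hlim'.comp (hφ.tendsto_atTop.comp hψ.tendsto_atTop))
  have hF' := fun N => hF (φ (ψ N))
  have hopt : ∑ s, shiftedCost m U₀ X₀ s ≤ sInf S := by
    rw [← hsum]
    refine Finset.sum_le_sum fun s _ => ?_
    rw [← (hl' s).liminf_eq]
    exact hL.shiftedCost_le_liminf hM hc hF' m s
  exact ⟨U₀, B₀, X₀, hL.feasible hM hF', (hopt.trans_lt hfin).ne, fun U' B' X' hF'' =>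
    hopt.trans (sInf_le ⟨U', B', X', hF'', rfl⟩)⟩

end TrafficModel

namespace TrafficModel

variable {V : Type*} {n : ℕ} {M : TrafficModel V n} [Fintype V]

/-! ### Existence of a flow for continuous departures -/

/-- Exit counts, or departures, that are continuous and start after time `0`. -/
structure IsProfile (f : ℝ → ℝ) : Prop where
  mono : Monotone f
  cont : Continuous f
  zero : ∀ t ≤ 0, f t = 0

theorem IsProfile.const_zero : IsProfile fun _ => 0 :=
  ⟨monotone_const, continuous_const, fun _ _ => rfl⟩

/-- A time `τ ≤ t - a` at which those drivers enter that exit at time `t`. -/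
noncomputable def entryTime (a : ℝ) (U : M.DriverClass → ℝ → ℝ)
    (X : M.DriverClass → V → V → ℝ → ℝ) (i j : V) (t : ℝ) : ℝ :=
  Classical.epsilon fun τ => τ ≤ t - a ∧
    totalEntered U X i j τ = infConv (totalEntered U X i j) (M.kernel i j) t

open Classical in
/-- The exit counts that result from the entry counts induced by `X`. -/
noncomputable def propagate (a : ℝ) (U : M.DriverClass → ℝ → ℝ)
    (X : M.DriverClass → V → V → ℝ → ℝ) (s : M.DriverClass) (i j : V) (t : ℝ) : ℝ :=
  if M.Viable i j then entered U X s i j (entryTime a U X i j t) else 0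

section Propagate

variable {a Λ : ℝ} {U : M.DriverClass → ℝ → ℝ} {X Y : M.DriverClass → V → V → ℝ → ℝ}

theorem entered_isProfile (hU : ∀ s, IsProfile (U s)) (hX : ∀ s i j, IsProfile (X s i j))
    (s : M.DriverClass) (i j : V) : IsProfile (entered U X s i j) :=
  entered_cases s i j (fun l _ _ _ => hX s l i) (fun _ => hU s) IsProfile.const_zero

theorem totalEntered_isProfile (hU : ∀ s, IsProfile (U s)) (hX : ∀ s i j, IsProfile (X s i j))
    (i j : V) : IsProfile (totalEntered U X i j) :=
  ⟨totalEntered_mono (fun s => (hU s).mono) (fun s i j => (hX s i j).mono) i j,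
    continuous_finsetSum _ fun s _ => (entered_isProfile hU hX s i j).cont,
    fun t ht => Finset.sum_eq_zero fun s _ => (entered_isProfile hU hX s i j).zero t ht⟩

theorem IsProfile.nonneg {f : ℝ → ℝ} (hf : IsProfile f) (t : ℝ) : 0 ≤ f t := by
  rcases le_total t 0 with h | h
  · exact (hf.zero t h).ge
  · exact (hf.zero 0 le_rfl).ge.trans (hf.mono h)

/-- The level lies between `0` and the entry count at `t - a`. The intermediate value theorem on
`[0, t - a]` applies, and for `t ≤ a` everything is zero. -/
theorem entryTime_spec (hU : ∀ s, IsProfile (U s)) (hX : ∀ s i j, IsProfile (X s i j)) {i j : V}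
    (hh : IsTravelKernel (M.kernel i j) a Λ) (t : ℝ) :
    entryTime a U X i j t ≤ t - a ∧ totalEntered U X i j (entryTime a U X i j t) =
      infConv (totalEntered U X i j) (M.kernel i j) t := by
  refine Classical.epsilon_spec (p := fun τ => τ ≤ t - a ∧
    totalEntered U X i j τ = infConv (totalEntered U X i j) (M.kernel i j) t) ?_
  have hf := totalEntered_isProfile hU hX i j
  have h1 := infConv_le_delay hf.nonneg hh t
  have h2 := infConv_nonneg hf.nonneg hh t
  rcases le_total (t - a) 0 with h | h
  · exact ⟨t - a, le_rfl, by rw [hf.zero _ h] at h1 ⊢; linarith⟩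
  · obtain ⟨τ, hτ, hτ'⟩ := intermediate_value_Icc h hf.cont.continuousOn
      ⟨(hf.zero 0 le_rfl).trans_le h2, h1⟩
    exact ⟨τ, hτ.2, hτ'⟩

/-- Nondecreasing functions whose sum does not change do not change either. Hence `propagate` does
not depend on which entry time was chosen. -/
theorem entered_eq_of_totalEntered_eq (hU : ∀ s, Monotone (U s))
    (hX : ∀ s i j, Monotone (X s i j)) {i j : V} {x y : ℝ}
    (h : totalEntered U X i j x = totalEntered U X i j y) (s : M.DriverClass) :
    entered U X s i j x = entered U X s i j y := by
  wlog hxy : x ≤ y generalizing x y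
  · exact (this h.symm (le_of_not_ge hxy)).symm
  have h1 := totalEntered_sub_entered_mono hU hX s i j hxy
  simp only at h1
  exact le_antisymm (entered_mono hU hX s i j hxy) (by linarith)

theorem sum_propagate (hU : ∀ s, IsProfile (U s)) (hX : ∀ s i j, IsProfile (X s i j)) {i j : V}
    (hv : M.Viable i j) (hh : IsTravelKernel (M.kernel i j) a Λ) (t : ℝ) :
    ∑ s, propagate a U X s i j t = infConv (totalEntered U X i j) (M.kernel i j) t := by
  simp only [propagate, if_pos hv]
  exact (entryTime_spec hU hX hh t).2

theorem propagate_mono (hU : ∀ s, IsProfile (U s)) (hX : ∀ s i j, IsProfile (X s i j))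
    (hh : ∀ i j, M.Viable i j → IsTravelKernel (M.kernel i j) a Λ) (s : M.DriverClass) (i j : V) :
    Monotone (propagate a U X s i j) := by
  intro x y hxy
  by_cases hv : M.Viable i j
  · simp only [propagate, if_pos hv]
    have hf := totalEntered_isProfile hU hX i j
    have h1 := (entryTime_spec hU hX (hh i j hv) x).2
    have h2 := (entryTime_spec hU hX (hh i j hv) y).2
    have h3 := infConv_mono hf.nonneg (hh i j hv) hxy
    rcases le_total (entryTime a U X i j x) (entryTime a U X i j y) with h | h
    · exact (entered_isProfile hU hX s i j).mono h
    · exact (entered_eq_of_totalEntered_eq (fun s => (hU s).mono) (fun s i j => (hX s i j).mono)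
        (le_antisymm (by linarith) (hf.mono h)) s).le
  · simp only [propagate, if_neg hv, le_refl]

theorem propagate_isProfile (hU : ∀ s, IsProfile (U s)) (hX : ∀ s i j, IsProfile (X s i j))
    (hh : ∀ i j, M.Viable i j → IsTravelKernel (M.kernel i j) a Λ) (s : M.DriverClass) (i j : V) :
    IsProfile (propagate a U X s i j) := by
  have hmono := propagate_mono hU hX hh
  refine ⟨hmono s i j, ?_, fun t ht => ?_⟩
  · by_cases hv : M.Viable i j
    · have hΛ := (hh i j hv).rate_nonneg
      refine LipschitzWith.continuous (K := Λ.toNNReal)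
        (LipschitzWith.of_le_add_mul _ fun x y => ?_)
      rw [Real.coe_toNNReal _ hΛ]
      rcases le_total y x with hyx | hxy
      · rw [Real.dist_eq, abs_of_nonneg (by linarith)]
        have h1 : propagate a U X s i j x - propagate a U X s i j y ≤
            ∑ s, (propagate a U X s i j x - propagate a U X s i j y) :=
          Finset.single_le_sum (f := fun s => propagate a U X s i j x - propagate a U X s i j y)
            (fun s _ => sub_nonneg.2 (hmono s i j hyx)) (Finset.mem_univ s)
        rw [Finset.sum_sub_distrib, sum_propagate hU hX hv (hh i j hv),
          sum_propagate hU hX hv (hh i j hv)] at h1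
        linarith [infConv_lip (totalEntered_isProfile hU hX i j).nonneg (hh i j hv) hyx]
      · have h1 : 0 ≤ Λ * dist x y := by positivity
        linarith [hmono s i j hxy]
    · rw [show propagate a U X s i j = fun _ => 0 from funext fun t => if_neg hv]
      exact continuous_const
  · unfold propagate
    split_ifs with hv
    · have := (entryTime_spec hU hX (hh i j hv) t).1
      exact (entered_isProfile hU hX s i j).zero _ (by linarith [(hh i j hv).delay_pos])
    · rfl

theorem propagate_of_not_uses {s : M.DriverClass} {i j : V} (hs : ¬ Uses s i j) (t : ℝ) :
    propagate a U X s i j t = 0 := by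
  unfold propagate
  rw [entered_of_not_uses hs, Pi.zero_apply, ite_self]

theorem entered_congr {t : ℝ} (h : ∀ s i j, X s i j t = Y s i j t) (s : M.DriverClass) (i j : V) :
    entered U X s i j t = entered U Y s i j t := by
  simp only [entered, h]

/-- Exits until time `T + a` depend only on the exits until time `T`. -/
theorem propagate_congr (hU : ∀ s, IsProfile (U s)) (hX : ∀ s i j, IsProfile (X s i j))
    (hY : ∀ s i j, IsProfile (Y s i j))
    (hh : ∀ i j, M.Viable i j → IsTravelKernel (M.kernel i j) a Λ) {T : ℝ}
    (h : ∀ s i j, ∀ t ≤ T, X s i j t = Y s i j t) (s : M.DriverClass) (i j : V) {t : ℝ}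
    (ht : t ≤ T + a) : propagate a U X s i j t = propagate a U Y s i j t := by
  unfold propagate
  split_ifs with hv
  swap
  · rfl
  have he : ∀ s, ∀ x ≤ T, entered U X s i j x = entered U Y s i j x := fun s x hx =>
    entered_congr (fun s i j => h s i j x hx) s i j
  have hf : ∀ x ≤ T, totalEntered U X i j x = totalEntered U Y i j x := fun x hx =>
    Finset.sum_congr rfl fun s _ => he s x hx
  have hfX := totalEntered_isProfile hU hX i j
  have hfY := totalEntered_isProfile hU hY i j
  have hc : infConv (totalEntered U X i j) (M.kernel i j) t =
      infConv (totalEntered U Y i j) (M.kernel i j) t :=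
    le_antisymm (infConv_le_of_eq_before hfX.nonneg hfY.mono (hh i j hv) hf ht)
      (infConv_le_of_eq_before hfY.nonneg hfX.mono (hh i j hv) (fun x hx => (hf x hx).symm) ht)
  obtain ⟨h1, h2⟩ := entryTime_spec hU hX (hh i j hv) t
  obtain ⟨-, h3⟩ := entryTime_spec hU hY (hh i j hv) t
  have hT : entryTime a U X i j t ≤ T := by linarith
  rw [he s _ hT]
  refine entered_eq_of_totalEntered_eq (fun s => (hU s).mono) (fun s i j => (hY s i j).mono) ?_ s
  rw [← hf _ hT, h2, h3, hc]

end Propagate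

/-- The method of steps: each application of `propagate` determines the exits for another time span
`a`, so the iterates stabilize up to time `m * a` after `m` steps. -/
theorem exists_propagate_eq {a Λ : ℝ} (ha : 0 < a) {U : M.DriverClass → ℝ → ℝ}
    (hU : ∀ s, IsProfile (U s))
    (hh : ∀ i j, M.Viable i j → IsTravelKernel (M.kernel i j) a Λ) :
    ∃ X : M.DriverClass → V → V → ℝ → ℝ, (∀ s i j, IsProfile (X s i j)) ∧
      ∀ s i j t, propagate a U X s i j t = X s i j t := by
  set Z : ℕ → M.DriverClass → V → V → ℝ → ℝ := fun m => (propagate a U)^[m] fun _ _ _ _ => 0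
    with hZ
  have hsucc : ∀ m, Z (m + 1) = propagate a U (Z m) := fun m =>
    Function.iterate_succ_apply' _ _ _
  have hprof : ∀ m s i j, IsProfile (Z m s i j) := by
    intro m
    induction m with
    | zero => exact fun s i j => IsProfile.const_zero
    | succ m ih => rw [hsucc]; exact propagate_isProfile hU ih hh
  have hstep : ∀ m : ℕ, ∀ s i j, ∀ t ≤ m * a, Z m s i j t = Z (m + 1) s i j t := by
    intro m
    induction m with
    | zero =>
      intro s i j t ht
      have ht' : t ≤ 0 := by simpa using ht
      rw [(hprof 0 s i j).zero t ht', (hprof 1 s i j).zero t ht']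
    | succ m ih =>
      intro s i j t ht
      rw [hsucc m, hsucc (m + 1)]
      refine propagate_congr hU (hprof m) (hprof (m + 1)) hh ih s i j ?_
      push_cast at ht
      linarith
  have hstable : ∀ m k : ℕ, m ≤ k → ∀ s i j, ∀ t ≤ m * a, Z m s i j t = Z k s i j t := by
    intro m k hmk
    induction k, hmk using Nat.le_induction with
    | base => exact fun _ _ _ _ _ => rfl
    | succ k hk ih =>
      intro s i j t ht
      rw [ih s i j t ht]
      refine hstep k s i j t (ht.trans ?_)
      gcongr
  -- At time `t` the iterate number `⌈t / a⌉₊` is already final.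
  set X : M.DriverClass → V → V → ℝ → ℝ := fun s i j t => Z ⌈t / a⌉₊ s i j t with hX
  have hXZ : ∀ m : ℕ, ∀ s i j, ∀ t ≤ m * a, X s i j t = Z m s i j t := by
    intro m s i j t ht
    refine hstable _ m ?_ s i j t ?_
    · exact Nat.ceil_le.2 ((div_le_iff₀ ha).2 ht)
    · exact (div_le_iff₀ ha).1 (Nat.le_ceil _)
  have harch : ∀ t : ℝ, ∃ m : ℕ, t < m * a := fun t => by
    obtain ⟨m, hm⟩ := exists_nat_gt (t / a)
    exact ⟨m, (div_lt_iff₀ ha).1 hm⟩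
  have hXprof : ∀ s i j, IsProfile (X s i j) := by
    refine fun s i j => ⟨fun x y hxy => ?_, continuous_iff_continuousAt.2 fun x => ?_,
      fun t ht => (hprof _ s i j).zero t ht⟩
    · obtain ⟨m, hm⟩ := harch y
      rw [hXZ m s i j y hm.le, hXZ m s i j x (hxy.trans hm.le)]
      exact (hprof m s i j).mono hxy
    · obtain ⟨m, hm⟩ := harch x
      refine (hprof m s i j).cont.continuousAt.congr ?_
      filter_upwards [gt_mem_nhds hm] with y hy using (hXZ m s i j y (le_of_lt hy)).symm
  refine ⟨X, hXprof, fun s i j t => ?_⟩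
  obtain ⟨m, hm⟩ := harch t
  rw [propagate_congr hU hXprof (hprof m) hh (hXZ m) s i j (hm.le.trans (by linarith)), ← hsucc]
  refine (hXZ (m + 1) s i j t ?_).symm
  push_cast
  linarith

/-- Continuous departures that start after time `0` have a corresponding traffic flow. -/
theorem exists_isFlow (hM : M.FluxAssumption) {U B : M.DriverClass → ℝ → ℝ}
    (hU : ∀ s, IsDepartureDistribution (U s)) (hU' : ∀ s, IsProfile (U s))
    (hB : IsPrioritizing U B) : ∃ X, IsFlow U B X := by
  obtain ⟨a₀, Λ, hh₀⟩ := exists_uniform_kernel hM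
  -- A nonpositive `a₀` is possible only if no arc is viable, and then any positive value will do.
  obtain ⟨a, ha, hh⟩ : ∃ a > 0, ∀ i j, M.Viable i j → IsTravelKernel (M.kernel i j) a Λ := by
    rcases lt_or_ge 0 a₀ with h | h
    · exact ⟨a₀, h, hh₀⟩
    · exact ⟨1, one_pos, fun i j hv => absurd (hh₀ i j hv).delay_pos (not_lt.2 h)⟩
  obtain ⟨X, hX, hfix⟩ := exists_propagate_eq ha hU' hh
  have hlax : ∀ i j, M.Viable i j → ∀ t,
      totalExited X i j t = infConv (totalEntered U X i j) (M.kernel i j) t := by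
    intro i j hv t
    rw [← sum_propagate hU' hX hv (hh i j hv) t]
    exact Finset.sum_congr rfl fun s _ => (hfix s i j t).symm
  have hentry : ∀ s i j, Uses s i j → ∀ t τ, IsEntryTime (totalEntered U X i j)
      (totalExited X i j t) τ → X s i j t = entered U X s i j τ ∧
        totalExited X i j t = totalEntered U X i j τ := by
    intro s i j hs t τ hτ
    have hc := (totalEntered_isProfile hU' hX i j).cont
    -- For a continuous entry count the two one-sided limits agree, so an entry time is an exact
    -- preimage of the level.
    have h1 : totalExited X i j t = totalEntered U X i j τ := by
      obtain ⟨h1, h2⟩ := hτ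
      rw [hc.continuousWithinAt.leftLim_eq] at h1
      rw [hc.continuousWithinAt.rightLim_eq] at h2
      exact le_antisymm h2 h1
    refine ⟨?_, h1⟩
    rw [← hfix, propagate, if_pos hs.viable]
    refine entered_eq_of_totalEntered_eq (fun s => (hU' s).mono) (fun s i j => (hX s i j).mono) ?_ s
    rw [(entryTime_spec hU' hX (hh i j hs.viable) t).2, ← hlax i j hs.viable, h1]
  refine ⟨X, fun s i j => (hX s i j).mono, fun s i j => ?_, fun s i j hs t => ?_,
    fun i j hv t => hlax i j hv t, fun s i j hs _ t τ hτ => (hentry s i j hs t τ hτ).1,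
    fun s i j hs t τ hτ => ?_⟩
  · refine tendsto_const_nhds.congr' ?_
    filter_upwards [eventually_le_atBot 0] with t ht using ((hX s i j).zero t ht).symm
  · rw [← hfix, propagate_of_not_uses hs]
  · obtain ⟨h1, h2⟩ := hentry s i j hs.uses t τ hτ
    rw [h1, h2, totalEntered_eq, add_sub_cancel_left, hB.comp_departCount hU hs,
      entered_of_starts hs]

/-! ### A feasible choice with finite cost -/

/-- The departure distribution of drivers that leave at constant rate between the times `0` and
`1`. -/
noncomputable def ramp (t : ℝ) : ℝ := max 0 (min 1 t)

theorem ramp_isProfile : IsProfile ramp :=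
  ⟨fun _ _ h => max_le_max le_rfl (min_le_min le_rfl h),
    continuous_const.max (continuous_const.min continuous_id),
    fun _ ht => max_eq_left ((min_le_right _ _).trans ht)⟩

theorem ramp_one : ramp 1 = 1 := by simp [ramp]

theorem ramp_le_one (t : ℝ) : ramp t ≤ 1 := max_le zero_le_one (min_le_left _ _)

section Ramp

variable {w : M.DriverClass → ℝ}

omit [Fintype V] in
theorem isProfile_mul_ramp (hw : ∀ s, 0 ≤ w s) (s : M.DriverClass) :
    IsProfile fun t => w s * ramp t :=
  ⟨ramp_isProfile.mono.const_mul (hw s), continuous_const.mul ramp_isProfile.cont,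
    fun t ht => by rw [ramp_isProfile.zero t ht, mul_zero]⟩

omit [Fintype V] in
theorem isDepartureDistribution_mul_ramp (hw : ∀ s, 0 ≤ w s) (s : M.DriverClass) :
    IsDepartureDistribution fun t => w s * ramp t := by
  have h := isProfile_mul_ramp hw s
  refine ⟨⟨w s, ?_⟩, h.mono, fun t => h.cont.continuousWithinAt, tendsto_const_nhds.congr' ?_⟩
  · rintro _ ⟨t, rfl⟩
    exact mul_le_of_le_one_right (hw s) (ramp_le_one t)
  · filter_upwards [eventually_le_atBot 0] with t ht using (h.zero t ht).symm

omit [Fintype V] in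
theorem size_mul_ramp (hw : ∀ s, 0 ≤ w s) (s : M.DriverClass) :
    size (fun s t => w s * ramp t) s = w s := by
  refine le_antisymm (ciSup_le fun t => mul_le_of_le_one_right (hw s) (ramp_le_one t)) ?_
  have := le_size (isDepartureDistribution_mul_ramp hw) s 1
  rwa [ramp_one, mul_one] at this

/-- If all groups depart at constant rates, then the proportional priorities are admissible. -/
theorem isPrioritizing_mul_ramp (hw : ∀ s, 0 ≤ w s) :
    IsPrioritizing (fun s t => w s * ramp t)
      fun s β => w s / startSize (fun s t => w s * ramp t) s * β := by
  classical
  set U : M.DriverClass → ℝ → ℝ := fun s t => w s * ramp t with hUdef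
  have hU : ∀ s, IsDepartureDistribution (U s) := isDepartureDistribution_mul_ramp hw
  have hcoef : ∀ s, 0 ≤ w s / startSize U s := fun s =>
    div_nonneg (hw s) (startSize_nonneg hU s)
  have hD : ∀ i j, departSize U i j = ∑ s with Starts s i j, w s := fun i j => by
    unfold departSize
    exact Finset.sum_congr (by congr) fun s _ => size_mul_ramp hw s
  refine ⟨fun s i j _ x _ y _ hxy => mul_le_mul_of_nonneg_left hxy (hcoef s),
    fun s i j hs β hβ => ⟨mul_nonneg (hcoef s) hβ.1, ?_⟩, fun i j β hβ => ?_,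
    fun s i j hs => Eventually.of_forall fun t => ?_⟩
  · rw [size_mul_ramp hw, startSize_eq U hs]
    calc w s / departSize U i j * β ≤ w s / departSize U i j * departSize U i j := by
          have := hcoef s
          rw [startSize_eq U hs] at this
          exact mul_le_mul_of_nonneg_left hβ.2 this
      _ ≤ w s := by
          rcases eq_or_ne (departSize U i j) 0 with h0 | h0
          · rw [h0, mul_zero]; exact hw s
          · rw [div_mul_cancel₀ _ h0]
  · have h1 : ∑ s with Starts s i j, w s / startSize U s * β =
        ∑ s with Starts s i j, w s * (β / departSize U i j) :=
      Finset.sum_congr (by congr) fun s hs => by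
        rw [startSize_eq U (Finset.mem_filter.1 hs).2]; ring
    rw [h1, ← Finset.sum_mul, ← hD]
    rcases eq_or_ne (departSize U i j) 0 with h0 | h0
    · rw [h0, zero_mul]
      rw [h0] at hβ
      exact le_antisymm hβ.1 hβ.2
    · exact mul_div_cancel₀ β h0
  · have h1 : departCount U i j t = departSize U i j * ramp t := by
      rw [hD, Finset.sum_mul]
      unfold departCount
      exact Finset.sum_congr (by congr) fun s _ => rfl
    rw [h1, startSize_eq U hs]
    -- If nobody starts on the arc, the quotient is a division by zero, but all weights on the arc
    -- vanish as well.
    rcases eq_or_ne (departSize U i j) 0 with h0 | h0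
    · have h2 : w s = 0 := by
        rw [hD] at h0
        exact (Finset.sum_eq_zero_iff_of_nonneg fun s _ => hw s).1 h0 s (by simpa using hs)
      simp [hUdef, h2]
    · rw [← mul_assoc, div_mul_cancel₀ _ h0]

end Ramp

/-- Each group uses a single path and departs at constant rate during `[0, 1]`. Everybody in a
subgroup leaves after time `0` and arrives by some finite `T`, so individual costs are bounded. -/
theorem exists_feasible (hM : M.FluxAssumption) (hc : M.CostAssumption)
    (hpath : ∀ k, Nonempty (M.Path k)) {G : Fin n → ℝ} (hG : ∀ k, 0 ≤ G k) (m : ℝ) :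
    ∃ U B X, IsFeasible (M := M) G U B X ∧ ∑ s, shiftedCost m U X s ≠ ⊤ := by
  classical
  let p : ∀ k, M.Path k := fun k => (hpath k).some
  set w : M.DriverClass → ℝ := fun s => if s.2 = p s.1 then G s.1 else 0 with hw'
  have hw : ∀ s, 0 ≤ w s := fun s => by
    simp only [hw']
    split_ifs
    exacts [hG _, le_rfl]
  have hU := isDepartureDistribution_mul_ramp hw
  have hB := isPrioritizing_mul_ramp hw
  obtain ⟨X, hX⟩ := exists_isFlow hM hU (isProfile_mul_ramp hw) hB
  have hA : IsAdmissible G fun s t => w s * ramp t := by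
    refine ⟨hU, fun k => ?_⟩
    refine (Finset.sum_congr rfl fun q _ => size_mul_ramp hw ⟨k, q⟩).trans ?_
    exact (Finset.sum_ite_eq' Finset.univ (p k) fun _ => G k).trans (if_pos (Finset.mem_univ _))
  have hF : IsFeasible G _ _ X := ⟨hA, hB, hX⟩
  refine ⟨_, _, X, hF, (ENNReal.sum_lt_top.2 fun s _ => ?_).ne⟩
  obtain ⟨T, hT⟩ := hF.exists_depart_le_arrived hM s 1
  rw [ramp_one, mul_one] at hT
  refine (setLIntegral_mono' (g := fun _ => ENNReal.ofReal
    (M.departCost s.1 0 + M.arriveCost s.1 T + m)) measurableSet_Ioc fun β hβ => ?_).trans_lt ?_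
  · rw [size_mul_ramp hw] at hβ
    refine ENNReal.ofReal_le_ofReal ?_
    have h1 : driverTime (arrived X s) β ≤ T :=
      driverTime_le (hF.arrived_mono s) (hF.arrived_tendsto s) hβ.1 (hβ.2.trans hT)
    have h2 : 0 ≤ driverTime (fun t => w s * ramp t) β :=
      le_driverTime (hU s).mono ⟨1, by rw [ramp_one, mul_one]; exact hβ.2⟩
        (by rw [ramp_isProfile.zero 0 le_rfl, mul_zero]; exact hβ.1)
    have h3 := hc.depart_anti s.1 h2
    have h4 := hc.arrive_mono s.1 h1
    unfold driverCost
    linarith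
  · rw [setLIntegral_const, Real.volume_Ioc]
    exact ENNReal.mul_lt_top ENNReal.ofReal_lt_top ENNReal.ofReal_lt_top

end TrafficModel

/-! ### Existence of a global optimum -/

theorem theorem1 {V : Type*} [Fintype V] {n : ℕ} (M : TrafficModel V n)
    (hflux : M.FluxAssumption) (hcost : M.CostAssumption)
    (hpath : ∀ k, Nonempty (M.Path k))
    (G : Fin n → ℝ) (hG : ∀ k, 0 ≤ G k) :
    ∃ (U B : M.DriverClass → ℝ → ℝ) (X : M.DriverClass → V → V → ℝ → ℝ),
      TrafficModel.IsAdmissible G U ∧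
      TrafficModel.IsPrioritizing U B ∧
      TrafficModel.IsFlow U B X ∧
      TrafficModel.totalCost U X < ⊤ ∧
      ∀ (U' B' : M.DriverClass → ℝ → ℝ) (X' : M.DriverClass → V → V → ℝ → ℝ),
        TrafficModel.IsAdmissible G U' →
        TrafficModel.IsPrioritizing U' B' →
        TrafficModel.IsFlow U' B' X' →
        TrafficModel.totalCost U X ≤ TrafficModel.totalCost U' X' := by
  obtain ⟨m, hm, hm'⟩ := hcost.exists_lower_bound
  obtain ⟨U, B, X, hF, hfin, hmin⟩ := TrafficModel.exists_minimizer hflux hcost hm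
    (TrafficModel.exists_feasible hflux hcost hpath hG m)
  refine ⟨U, B, X, hF.admissible, hF.prioritizing, hF.flow, ?_, fun U' B' X' hA' hB' hX' => ?_⟩
  · rw [hF.totalCost_eq hflux hcost hm hm']
    refine EReal.add_lt_top (fun h => hfin ?_) (EReal.coe_ne_top _)
    exact EReal.coe_ennreal_eq_top_iff.1 h
  · have hF' : TrafficModel.IsFeasible G U' B' X' := ⟨hA', hB', hX'⟩
    rw [hF.totalCost_eq hflux hcost hm hm', hF'.totalCost_eq hflux hcost hm hm']
    gcongr
    exact EReal.coe_ennreal_le_coe_ennreal_iff.2 (hmin U' B' X' hF')
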